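/- **Setting.** Let $N\ge 2$, $K$ and $B\ge 0$ be integers. Vectors of $\mathbb{C}^{1\times N}$ are rows. For $x\neq 0$ write $\tilde x = x/\|x\|$. A random unit vector is *isotropic* in a subspace $S$ if it lies in $S$ and its law is invariant under every unitary map that preserves $S$. *Rayleigh fading and random vector quantization.* Let $\mathbf h$ be a random vector in $\mathbb{C}^{1\times N}$ whose entries are i.i.d. circularly symmetric complex Gaussian with mean $0$ and variance $1$, and put $A^{\rm ave}=\mathbb{E}\|\mathbf h\|^2$. Let $\mathbf c_1,\dots,\mathbf c_{2^B}$ be independent isotropic unit vectors in $\mathbb{C}^{1\times N}$, independent of $\mathbf h$. Let $\mathbf q$ be a vector among the $\mathbf c_n$ that maximizes $|\mathbf c_n\tilde{\mathbf h}^{\rm H}|$, and let $\sin^2\angle(\tilde{\mathbf h},\mathbf q)=1-|\mathbf q\tilde{\mathbf h}^{\rm H}|^2$. *Zero-forcing vector.* Let $\hat{\mathbf h}_1,\dots,\hat{\mathbf h}_K\in\mathbb{C}^{1\times N}$ be (random or deterministic) unit vectors, almost surely linearly independent, and let $\xi_1,\dots,\xi_K>0$. Let $\check{\mathbf H}$ be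 the $K\times N$ matrix with rows $\xi_i\sqrt{A^{\rm ave}}\,\hat{\mathbf h}_i$, let $\check{\mathbf H}^\dagger$ be its Moore–Penrose pseudo-inverse, and let $\tilde{\mathbf w}_k^{\rm ZF}$ be the $k$-th column of $\check{\mathbf H}^\dagger$ divided by its Euclidean norm. *Reconstructed channel.* Fix users $j\neq k$. Let $\tilde{\mathbf h}_j^\diamond=\sqrt{1-Z}\,\hat{\mathbf h}_j+\sqrt Z\,\mathbf e_j^\diamond$ and let $A_j^\diamond$ be a random variable, where - $A_j^\diamond$ has the law of $\|\mathbf h\|^2$ (that is, chi-square with $2N$ degrees of freedom, each of variance $1/2$), and $Z$ has the law of $\sin^2\angle(\tilde{\mathbf h},\mathbf q)$; - conditionally on $(\hat{\mathbf h}_i)_i$, the vector $\mathbf e_j^\diamond$ is an isotropic unit vector in the $(N-1)$-dimensional orthogonal complement of $\hat{\mathbf h}_j$; - $A_j^\diamond$, $Z$ and the pair $\big((\hat{\mathbf h}_i)_i,\mathbf e_j^\diamond\big)$ are mutually independent. **Theorem.** Let $D=\left|\sqrt{A_j^\diamond}\,\tilde{\mathbf h}_j^\diamond\tilde{\mathbf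 w}_k^{\rm ZF}\right|^2$. Then $D$ is a random variable whose cumulative distribution function $P_D(d)=\Pr(D\le d)$ is $0$ for $d\le 0$ and, for $d>0$, with $\mathrm E_1(x)=\int_x^\infty \frac{e^{-t}}{t}\,dt$, $$ \begin{aligned} P_D(d)={}&1+\frac{e^{-d}}{(N-2)!}\sum_{n=0}^{N-2}\sum_{m=1}^{2^B}\binom{N-2}{n}\binom{2^B}{m}\frac{(-1)^{n+m}m}{mN-(m+n)}\sum_{l=0}^{N-1-n}l!\binom{N-1-n}{l}d^{N-1-l}\\ &-\frac{e^{-d}}{(N-2)!}\sum_{n=0}^{N-2}\binom{N-2}{n}\binom{2^B}{1}\frac{(-1)^{n+1}}{N-1-n}\,d^{N-1}\\ &-\frac{e^{-d}}{(N-2)!}\sum_{n=0}^{N-2}\sum_{m=2}^{2^B}\binom{N-2}{n}\binom{2^B}{m}\frac{(-1)^{n+m}m}{mN-(m+n)}\sum_{l=1}^{(m-1)(N-1)-1}\frac{(-1)^{l-1}d^{N-1+l}}{l!\binom{(m-1)(N-1)-1}{l}}\\ &-\frac{\mathrm E_1(d)}{(N-2)!}\sum_{n=0}^{N-2}\sum_{m=2}^{2^B}\binom{N-2}{n}\binom{2^B}{m}\frac{(-1)^{n+m}m}{mN-(m+n)}\cdot\frac{(-1)^{(m-1)(N-1)-1}d^{m(N-1)}}{((m-1)(N-1)-1)!}.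 \end{aligned} $$ -/

import Mathlib

open MeasureTheory ProbabilityTheory

open scoped Matrix

noncomputable section

/-- The exponential integral `E₁(x) = ∫_x^∞ e^{-t} / t dt` (for `x > 0`). -/
def expIntegralE1 (x : ℝ) : ℝ :=
  ∫ t in Set.Ioi x, Real.exp (-t) / t

/-- The circularly symmetric complex Gaussian law with mean `0` and variance `1`:
independent real and imaginary parts, each centred Gaussian with variance `1/2`. -/
def stdComplexGaussian : Measure ℂ :=
  ((gaussianReal 0 (1 / 2)).prod (gaussianReal 0 (1 / 2))).map
    Complex.measurableEquivRealProd.symm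

/-- The law on `ℂ^N` of an i.i.d. Rayleigh fading channel vector: the entries are i.i.d.
circularly symmetric complex Gaussian with unit variance. -/
def rayleighLaw (N : ℕ) : Measure (EuclideanSpace ℂ (Fin N)) :=
  (Measure.pi fun _ : Fin N => stdComplexGaussian).map (WithLp.toLp 2)

/-- The average channel gain `A^ave = 𝔼 ‖h‖²` of a Rayleigh fading channel vector. -/
def avgGain (N : ℕ) : ℝ :=
  ∫ x, ‖x‖ ^ 2 ∂(rayleighLaw N)

/-- `μ` is the law of a unit vector isotropically distributed in the subspace `S` of `ℂ^N`:
it is carried by the unit sphere of `S`, and every unitary map of `ℂ^N` that preserves `S`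
leaves it invariant. -/
structure IsIsotropicIn {N : ℕ} (μ : Measure (EuclideanSpace ℂ (Fin N)))
    (S : Submodule ℂ (EuclideanSpace ℂ (Fin N))) : Prop where
  isProbabilityMeasure : IsProbabilityMeasure μ
  mem_sphere : ∀ᵐ x ∂μ, x ∈ S ∧ ‖x‖ = 1
  invariant : ∀ U : EuclideanSpace ℂ (Fin N) ≃ₗᵢ[ℂ] EuclideanSpace ℂ (Fin N),
    (∀ x, U x ∈ S ↔ x ∈ S) → μ.map U = μ

/-- The channel direction `h / ‖h‖`. -/
def direction {N : ℕ} (h : EuclideanSpace ℂ (Fin N)) : EuclideanSpace ℂ (Fin N) :=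
  ((‖h‖⁻¹ : ℝ) : ℂ) • h

/-- `sin²` of the angle between the direction of `h` and the unit vector `c`, where the cosine
of that angle is the modulus of the Hermitian product of the two unit vectors. -/
def sinSqAngle {N : ℕ} (h c : EuclideanSpace ℂ (Fin N)) : ℝ :=
  1 - ‖inner ℂ (direction h) c‖ ^ 2

/-- Random vector quantization of the direction of a Rayleigh fading channel vector `h` with
`B` bits: the codebook `c` consists of `2 ^ B` independent isotropic unit vectors, independent
of `h`, and `q` is a codeword that maximizes `|c h̃ᴴ|`, with `h̃ = h / ‖h‖`. -/
structure IsRVQ {Ω : Type*} [MeasurableSpace Ω] (P : Measure Ω) {N B : ℕ}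
    (h : Ω → EuclideanSpace ℂ (Fin N)) (c : Fin (2 ^ B) → Ω → EuclideanSpace ℂ (Fin N))
    (q : Ω → EuclideanSpace ℂ (Fin N)) : Prop where
  channel_law : HasLaw h (rayleighLaw N) P
  codeword_aemeasurable : ∀ n, AEMeasurable (c n) P
  codeword_isotropic : ∀ n, IsIsotropicIn (P.map (c n)) ⊤
  codebook_indep : iIndepFun c P
  channel_indep : IndepFun h (fun ω n => c n ω) P
  selection : ∀ᵐ ω ∂P, (∃ n, q ω = c n ω) ∧
    ∀ n, ‖inner ℂ (direction (h ω)) (c n ω)‖ ≤ ‖inner ℂ (direction (h ω)) (q ω)‖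

/-- The four Penrose equations: `X` is the Moore-Penrose pseudo-inverse of `M`. -/
structure IsMoorePenrose {m n : Type*} [Fintype m] [Fintype n]
    (M : Matrix m n ℂ) (X : Matrix n m ℂ) : Prop where
  mul_mul_self : M * X * M = M
  mul_mul_inv : X * M * X = X
  left_herm : (M * X)ᴴ = M * X
  right_herm : (X * M)ᴴ = X * M

open scoped Classical in
/-- The Moore-Penrose pseudo-inverse of a complex matrix. -/
def pinv {m n : Type*} [Fintype m] [Fintype n] (M : Matrix m n ℂ) : Matrix n m ℂ :=
  if hM : ∃ X, IsMoorePenrose M X then hM.choose else 0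

/-- The channel matrix known to the base station: its `i`-th row is
`ξ i * √(A^ave) * ĥ i`. -/
def csiMatrix {N K : ℕ} (ξ : Fin K → ℝ) (H : Fin K → EuclideanSpace ℂ (Fin N)) :
    Matrix (Fin K) (Fin N) ℂ :=
  Matrix.of fun i n => ((ξ i * √(avgGain N) : ℝ) : ℂ) * H i n

/-- The normalized zero-forcing vector of user `k`: the `k`-th column of the pseudo-inverse of
the channel matrix known to the base station, divided by its Euclidean norm. -/
def zfVector {N K : ℕ} (ξ : Fin K → ℝ) (H : Fin K → EuclideanSpace ℂ (Fin N)) (k : Fin K) :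
    EuclideanSpace ℂ (Fin N) :=
  direction (WithLp.toLp 2 ((pinv (csiMatrix ξ H)).col k))

/-- The direction reconstructed at the base station, `h̃ = √(1 - Z) ĥ + √Z e`. -/
def reconstructedDirection {N : ℕ} (z : ℝ) (hhat e : EuclideanSpace ℂ (Fin N)) :
    EuclideanSpace ℂ (Fin N) :=
  ((√(1 - z) : ℝ) : ℂ) • hhat + ((√z : ℝ) : ℂ) • e

/-- `|√a · h̃ w|²`, where `h̃ w = ∑ₙ h̃ₙ wₙ` is the product of a row and a column. -/
def leakage {N : ℕ} (a : ℝ) (x w : EuclideanSpace ℂ (Fin N)) : ℝ :=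
  ‖((√a : ℝ) : ℂ) * ∑ n, x n * w n‖ ^ 2

end

/-! Since `k ≠ j`, zero forcing annihilates the quantized direction of user `j`, so only the error
component of the reconstructed channel leaks. Hence, almost surely, `D = A * Z * W` with `W = |e
w|²`, and the three factors are independent. The gain `A` is a sum of `N` independent exponential
variables (`map_normSq_rayleighLaw`). Given the channel, the squared projections of the codewords on
its direction are independent `Beta(1, N - 1)` variables, so `Z` is a minimum of `2 ^ B` independent
`Beta(N - 1, 1)` variables (`IsRVQ.map_sinSqAngle`). Given the quantized directions, `e` is
isotropic in a space of dimension `N - 1` that contains the conjugate of the unit vector `w`. So `W`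
is `Beta(1, N - 2)`, whatever these directions are (`hasBetaOneTail_zeroForcing`). For `N = 2` this
is the constant `1`, a case that the description of `W` by its tail covers. Both Beta laws come from
`IsIsotropicIn.measure_lt_normSq_inner`, which compares an isotropic vector with a Gaussian one; for
the latter, the normalized squared projection is one exponential variable divided by a sum of
independent ones. For `0 < x < 1`, binomial expansion makes `Pr(Z W > x)` a polynomial in `x`
(`integral_minBeta_density_mul`). Setting `x = d / a` and integrating against the Erlang density
over `a > d` leaves integrals of `a ^ p * exp (-a)`. Integration by parts turns those with `p ≥ 0`
into finite sums and reduces those with `p < 0` to `E₁`. The calculations use `r = N - 2` and `m = k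
+ 1`. -/

/-! ### Erlang laws and squared norms of complex Gaussian vectors. -/

/-- The Gamma law with integer shape `n + 1` and rate `1`. -/
noncomputable def erlangMeasure (n : ℕ) : Measure ℝ :=
  (volume.restrict (Set.Ioi 0)).withDensity
    fun u => ENNReal.ofReal (u ^ n * Real.exp (-u) / n.factorial)

lemma measurable_erlang_density (n : ℕ) :
    Measurable fun u : ℝ => ENNReal.ofReal (u ^ n * Real.exp (-u) / n.factorial) := by
  fun_prop

lemma lintegral_erlangMeasure (n : ℕ) {f : ℝ → ENNReal} (hf : Measurable f) :
    ∫⁻ u, f u ∂erlangMeasure n =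
      ∫⁻ u in Set.Ioi 0, ENNReal.ofReal (u ^ n * Real.exp (-u) / n.factorial) * f u := by
  rw [erlangMeasure, lintegral_withDensity_eq_lintegral_mul _ (measurable_erlang_density n) hf]
  rfl

lemma gaussianPDF_half_mul (x y : ℝ) :
    gaussianPDF 0 (1 / 2) x * gaussianPDF 0 (1 / 2) y =
      ENNReal.ofReal (Real.pi⁻¹ * Real.exp (-(x ^ 2 + y ^ 2))) := by
  rw [gaussianPDF, gaussianPDF, ← ENNReal.ofReal_mul (gaussianPDFReal_nonneg _ _ _)]
  congr 1
  simp only [gaussianPDFReal]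
  have h1 : (2 * Real.pi * ((1 / 2 : NNReal) : ℝ)) = Real.pi := by push_cast; ring
  rw [h1]
  have h2 : (√Real.pi)⁻¹ * (√Real.pi)⁻¹ = Real.pi⁻¹ := by
    rw [← mul_inv, Real.mul_self_sqrt Real.pi_pos.le]
  calc _ = ((√Real.pi)⁻¹ * (√Real.pi)⁻¹) *
        (Real.exp (-(x - 0) ^ 2 / (2 * ((1 / 2 : NNReal) : ℝ))) *
          Real.exp (-(y - 0) ^ 2 / (2 * ((1 / 2 : NNReal) : ℝ)))) := by ring
    _ = _ := by
      rw [h2, ← Real.exp_add]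
      congr 2
      push_cast
      ring

/-- In polar coordinates the density depends on the radius only: the angle contributes `2π`, and `u
= r ^ 2` turns `2 r exp (-r ^ 2) dr` into `exp (-u) du`. -/
lemma map_normSq_stdComplexGaussian :
    stdComplexGaussian.map (fun z => ‖z‖ ^ 2) = erlangMeasure 0 := by
  refine Measure.ext_of_lintegral _ fun f hf => ?_
  rw [lintegral_map hf (by fun_prop), stdComplexGaussian,
    lintegral_map (by fun_prop) (MeasurableEquiv.measurable _),
    lintegral_erlangMeasure _ hf]
  have hv : (1 / 2 : NNReal) ≠ 0 := by simp
  have hfm : Measurable fun z : ℂ => f (‖z‖ ^ 2) := by fun_prop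
  rw [gaussianReal_of_var_ne_zero _ hv,
    prod_withDensity (measurable_gaussianPDF _ _) (measurable_gaussianPDF _ _)]
  simp only [gaussianPDF_half_mul]
  rw [← Measure.volume_eq_prod]
  refine (lintegral_withDensity_eq_lintegral_mul _ (by fun_prop)
    (hfm.comp Complex.measurableEquivRealProd.symm.measurable)).trans ?_
  rw [← lintegral_comp_polarCoord_symm]
  have key : ∀ p : ℝ × ℝ, ENNReal.ofReal p.1 •
      ((fun z : ℝ × ℝ => ENNReal.ofReal (Real.pi⁻¹ * Real.exp (-(z.1 ^ 2 + z.2 ^ 2)))) *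
        ((fun z : ℂ => f (‖z‖ ^ 2)) ∘ Complex.measurableEquivRealProd.symm)) (polarCoord.symm p) =
      ENNReal.ofReal p.1 * (ENNReal.ofReal (Real.pi⁻¹ * Real.exp (-(p.1 ^ 2))) * f (p.1 ^ 2)) := by
    rintro ⟨r, θ⟩
    have h1 : (r * Real.cos θ) ^ 2 + (r * Real.sin θ) ^ 2 = r ^ 2 := by
      linear_combination r ^ 2 * Real.sin_sq_add_cos_sq θ
    have h2 : ‖Complex.measurableEquivRealProd.symm (r * Real.cos θ, r * Real.sin θ)‖ ^ 2 =
        r ^ 2 := by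
      rw [← h1, ← Complex.normSq_eq_norm_sq, Complex.normSq_apply]
      simp [Complex.measurableEquivRealProd]
      ring
    simp only [polarCoord_symm_apply, Pi.mul_apply, Function.comp_apply, smul_eq_mul, h1, h2]
  refine (lintegral_congr key).trans ?_
  rw [polarCoord_target, Measure.volume_eq_prod, ← Measure.prod_restrict,
    lintegral_prod _ (by fun_prop)]
  simp only [lintegral_const, Measure.restrict_apply_univ, Real.volume_Ioo]
  have himg : (fun r : ℝ => r ^ 2) '' Set.Ioi 0 = Set.Ioi 0 := by
    ext u
    constructor
    · rintro ⟨r, hr, rfl⟩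
      exact pow_pos (Set.mem_Ioi.1 hr) 2
    · intro hu
      exact ⟨√u, Real.sqrt_pos.2 hu, Real.sq_sqrt (le_of_lt hu)⟩
  have hcv := lintegral_image_eq_lintegral_deriv_mul_of_monotoneOn (s := Set.Ioi 0)
    (f := fun r : ℝ => r ^ 2) (f' := fun r => 2 * r) measurableSet_Ioi
    (fun x _ => by simpa using (hasDerivAt_pow 2 x).hasDerivWithinAt)
    (fun x hx y _ hxy => pow_le_pow_left₀ (le_of_lt hx) hxy 2)
    (fun u => ENNReal.ofReal (u ^ 0 * Real.exp (-u) / (Nat.factorial 0 : ℕ)) * f u)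
  rw [himg] at hcv
  rw [hcv]
  refine setLIntegral_congr_fun measurableSet_Ioi fun r hr => ?_
  have hr' : (0 : ℝ) < r := hr
  have hpi := Real.pi_pos
  simp only [pow_zero, one_mul, Nat.factorial_zero, Nat.cast_one, div_one]
  rw [← mul_assoc, ← mul_assoc, ← ENNReal.ofReal_mul hr'.le, ← ENNReal.ofReal_mul (by positivity),
    mul_right_comm, ← ENNReal.ofReal_mul (by positivity)]
  congr 2
  field_simp
  ring

instance : IsProbabilityMeasure stdComplexGaussian := by
  unfold stdComplexGaussian
  exact Measure.isProbabilityMeasure_map (MeasurableEquiv.measurable _).aemeasurable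

instance (N : ℕ) : IsProbabilityMeasure (rayleighLaw N) := by
  unfold rayleighLaw
  exact Measure.isProbabilityMeasure_map (WithLp.measurable_toLp 2 _).aemeasurable

instance : IsProbabilityMeasure (erlangMeasure 0) := by
  rw [← map_normSq_stdComplexGaussian]
  exact Measure.isProbabilityMeasure_map (by fun_prop)

lemma setLIntegral_Ioi_comp_add (s : ℝ) (g : ℝ → ENNReal) :
    ∫⁻ u in Set.Ioi 0, g (s + u) = ∫⁻ u in Set.Ioi s, g u := by
  rw [← lintegral_indicator measurableSet_Ioi, ← lintegral_indicator measurableSet_Ioi,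
    ← lintegral_add_left_eq_self ((Set.Ioi s).indicator fun u => g u) s]
  congr 1
  ext u
  simp [Set.indicator_apply]

/-- The convolution step for sums of exponentials: after the shift `u = s + t` the exponential
depends on `u` alone, and Tonelli on `0 < s < u` leaves the integral of `(u - s) ^ n`, which is `u ^
(n + 1) / (n + 1)`. -/
lemma lintegral_erlangMeasure_add (n : ℕ) {f : ℝ → ENNReal} (hf : Measurable f) :
    ∫⁻ s, ∫⁻ t, f (s + t) ∂erlangMeasure n ∂erlangMeasure 0 =
      ∫⁻ u, f u ∂erlangMeasure (n + 1) := by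
  have hm : Measurable fun s => ∫⁻ t, f (s + t) ∂erlangMeasure n := by
    have : SFinite (erlangMeasure n) := by unfold erlangMeasure; infer_instance
    exact Measurable.lintegral_prod_right' (f := fun p : ℝ × ℝ => f (p.1 + p.2)) (by fun_prop)
  rw [lintegral_erlangMeasure _ hm, lintegral_erlangMeasure _ hf]
  have hin : ∀ s, ∫⁻ t, f (s + t) ∂erlangMeasure n = ∫⁻ t in Set.Ioi 0,
      ENNReal.ofReal (t ^ n * Real.exp (-t) / n.factorial) * f (s + t) := fun s =>
    lintegral_erlangMeasure n (hf.comp (measurable_const_add s))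
  simp only [hin]
  have step : ∀ s : ℝ, ENNReal.ofReal (s ^ 0 * Real.exp (-s) / (Nat.factorial 0 : ℕ)) *
      ∫⁻ t in Set.Ioi 0, ENNReal.ofReal (t ^ n * Real.exp (-t) / n.factorial) * f (s + t) =
      ∫⁻ u in Set.Ioi s, ENNReal.ofReal ((u - s) ^ n * Real.exp (-u) / n.factorial) * f u := by
    intro s
    rw [← lintegral_const_mul _ (by fun_prop), ← setLIntegral_Ioi_comp_add s]
    refine setLIntegral_congr_fun measurableSet_Ioi fun t ht => ?_
    have ht' : (0 : ℝ) < t := ht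
    rw [← mul_assoc, ← ENNReal.ofReal_mul (by positivity)]
    congr 2
    rw [add_sub_cancel_left, neg_add, Real.exp_add]
    simp
    ring
  simp only [step]
  -- The moving domain becomes an indicator, so that both integrals run over fixed sets and can be
  -- swapped.
  have ind : ∀ s : ℝ, ∫⁻ u in Set.Ioi s,
      ENNReal.ofReal ((u - s) ^ n * Real.exp (-u) / n.factorial) * f u =
      ∫⁻ u, (Set.Ioi s).indicator (fun u =>
        ENNReal.ofReal ((u - s) ^ n * Real.exp (-u) / n.factorial) * f u) u :=
    fun s => (lintegral_indicator measurableSet_Ioi _).symm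
  simp only [ind]
  rw [lintegral_lintegral_swap, ← lintegral_indicator measurableSet_Ioi]
  · congr 1
    ext u
    by_cases hu : 0 < u
    · rw [Set.indicator_of_mem (Set.mem_Ioi.2 hu)]
      have e1 : ∀ s : ℝ, (Set.Ioi s).indicator (fun u =>
          ENNReal.ofReal ((u - s) ^ n * Real.exp (-u) / n.factorial) * f u) u =
          (Set.Iio u).indicator (fun s =>
            ENNReal.ofReal ((u - s) ^ n * Real.exp (-u) / n.factorial) * f u) s := by
        intro s; simp [Set.indicator_apply]
      simp only [e1]
      rw [lintegral_indicator measurableSet_Iio, Measure.restrict_restrict measurableSet_Iio,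
        lintegral_mul_const _ (by fun_prop)]
      congr 1
      have hset : Set.Iio u ∩ Set.Ioi 0 = Set.Ioo 0 u := by
        ext; simp [and_comm]
      rw [hset, restrict_Ioo_eq_restrict_Ioc,
        ← ofReal_integral_eq_lintegral_ofReal, ← intervalIntegral.integral_of_le hu.le]
      · congr 1
        have : ∀ x : ℝ, (u - x) ^ n * Real.exp (-u) / n.factorial =
          (u - x) ^ n * (Real.exp (-u) / n.factorial) := fun x => by ring
        simp only [this]
        rw [intervalIntegral.integral_mul_const,
          intervalIntegral.integral_comp_sub_left (fun x => x ^ n) u, integral_pow]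
        simp [Nat.factorial_succ]
        field_simp
      · exact (by fun_prop : Continuous fun x : ℝ =>
          (u - x) ^ n * Real.exp (-u) / n.factorial).integrableOn_Ioc
      · filter_upwards [ae_restrict_mem measurableSet_Ioc] with x hx
        have : 0 ≤ u - x := sub_nonneg.2 hx.2
        positivity
    · rw [Set.indicator_of_notMem (by simpa using hu)]
      rw [← nonpos_iff_eq_zero]
      refine (setLIntegral_mono' (g := fun _ => 0) measurableSet_Ioi fun s hs => ?_).trans (by simp)
      have hs' : (0 : ℝ) < s := hs
      rw [Set.indicator_of_notMem]
      simp only [Set.mem_Ioi, not_lt]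
      linarith [not_lt.1 hu]
  · refine Measurable.aemeasurable ?_
    have : (Function.uncurry fun s u : ℝ => (Set.Ioi s).indicator (fun u =>
        ENNReal.ofReal ((u - s) ^ n * Real.exp (-u) / n.factorial) * f u) u) =
        {p : ℝ × ℝ | p.1 < p.2}.indicator (fun p =>
          ENNReal.ofReal ((p.2 - p.1) ^ n * Real.exp (-p.2) / n.factorial) * f p.2) := by
      ext ⟨s, u⟩
      simp [Function.uncurry, Set.indicator_apply]
    rw [this]
    exact Measurable.indicator (by fun_prop) (measurableSet_lt measurable_fst measurable_snd)

lemma map_sum_pi_erlangMeasure (n : ℕ) :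
    (Measure.pi fun _ : Fin (n + 1) => erlangMeasure 0).map (fun x => ∑ i, x i) =
      erlangMeasure n := by
  induction n with
  | zero =>
    have h := measurePreserving_eval (fun _ : Fin 1 => erlangMeasure 0) 0
    refine Eq.trans ?_ h.map_eq
    congr 1
    ext x
    simp
  | succ n ih =>
    refine Measure.ext_of_lintegral _ fun f hf => ?_
    have h := measurePreserving_piFinSuccAbove (fun _ : Fin (n + 1 + 1) => erlangMeasure 0) 0
    have hs : (fun x : Fin (n + 1 + 1) → ℝ => ∑ i, x i) =
        (fun p : ℝ × (Fin (n + 1) → ℝ) => p.1 + ∑ i, p.2 i) ∘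
          (MeasurableEquiv.piFinSuccAbove (fun _ => ℝ) 0) := by
      ext x
      simp [Fin.sum_univ_succ (n := n + 1), MeasurableEquiv.piFinSuccAbove, Fin.tail]
    rw [hs, ← Measure.map_map (by fun_prop) (MeasurableEquiv.measurable _), h.map_eq,
      lintegral_map hf (by fun_prop), lintegral_prod _ (by fun_prop),
      ← lintegral_erlangMeasure_add n hf, ← ih]
    congr 1
    ext s
    rw [lintegral_map (by fun_prop) (by fun_prop)]

lemma map_normSq_pi_stdComplexGaussian (N : ℕ) :
    (Measure.pi fun _ : Fin N => stdComplexGaussian).map (fun x i => ‖x i‖ ^ 2) =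
      Measure.pi fun _ : Fin N => erlangMeasure 0 := by
  have := map_normSq_stdComplexGaussian
  have hp : ∀ _ : Fin N, SigmaFinite (stdComplexGaussian.map (fun z => ‖z‖ ^ 2)) := fun _ => by
    rw [this]; infer_instance
  rw [Measure.pi_map_pi (f := fun _ (z : ℂ) => ‖z‖ ^ 2) (fun _ => by fun_prop), this]

/-- The squared norm of a Rayleigh fading channel vector has an Erlang law. -/
lemma map_normSq_rayleighLaw (n : ℕ) :
    (rayleighLaw (n + 1)).map (fun x => ‖x‖ ^ 2) = erlangMeasure n := by
  rw [rayleighLaw, Measure.map_map (by fun_prop) (WithLp.measurable_toLp 2 _),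
    ← map_sum_pi_erlangMeasure, ← map_normSq_pi_stdComplexGaussian,
    Measure.map_map (by fun_prop) (by fun_prop)]
  congr 1
  ext x
  simp [EuclideanSpace.norm_sq_eq]

/-! ### Unitary invariance of Gaussian and isotropic vectors. -/

lemma charFun_stdComplexGaussian (t : ℂ) :
    charFun stdComplexGaussian t = Complex.exp (-(‖t‖ ^ 2 : ℝ) / 4) := by
  rw [charFun_apply, stdComplexGaussian, integral_map (MeasurableEquiv.measurable _).aemeasurable
    (by fun_prop)]
  have : ∀ p : ℝ × ℝ, Complex.exp ((inner ℝ (Complex.measurableEquivRealProd.symm p) t : ℝ)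
      * Complex.I) = Complex.exp ((t.re * p.1 : ℝ) * Complex.I) *
        Complex.exp ((t.im * p.2 : ℝ) * Complex.I) := by
    intro p
    rw [← Complex.exp_add]
    congr 1
    simp [Complex.measurableEquivRealProd, Complex.inner]
    ring
  simp only [this]
  rw [integral_prod_mul (fun x : ℝ => Complex.exp ((t.re * x : ℝ) * Complex.I))
    (fun x : ℝ => Complex.exp ((t.im * x : ℝ) * Complex.I))]
  have h1 := charFun_gaussianReal (μ := 0) (v := 1 / 2) t.re
  have h2 := charFun_gaussianReal (μ := 0) (v := 1 / 2) t.im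
  rw [charFun_apply_real] at h1 h2
  push_cast at h1 h2 ⊢
  rw [h1, h2, ← Complex.exp_add]
  congr 1
  have := Complex.normSq_eq_norm_sq t
  rw [Complex.normSq_apply] at this
  have h3 : ((‖t‖ : ℝ) : ℂ) ^ 2 = t.re * t.re + t.im * t.im := by exact_mod_cast this.symm
  rw [h3]
  ring

/-- Only the norm of `t` enters; this is the source of unitary invariance. -/
lemma charFun_rayleighLaw (N : ℕ) (t : EuclideanSpace ℂ (Fin N)) :
    charFun (rayleighLaw N) t = Complex.exp (-(‖t‖ ^ 2 : ℝ) / 4) := by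
  rw [rayleighLaw, charFun_pi]
  simp only [charFun_stdComplexGaussian]
  rw [← Complex.exp_sum, EuclideanSpace.norm_sq_eq]
  congr 1
  push_cast
  rw [neg_div, Finset.sum_div, ← Finset.sum_neg_distrib]
  simp [neg_div]

/-- A Rayleigh fading channel vector is unitarily invariant. -/
lemma map_rayleighLaw (N : ℕ) (U : EuclideanSpace ℂ (Fin N) ≃ₗᵢ[ℂ] EuclideanSpace ℂ (Fin N)) :
    (rayleighLaw N).map U = rayleighLaw N := by
  have hU : Measurable U := U.continuous.measurable
  have := Measure.isProbabilityMeasure_map (μ := rayleighLaw N) hU.aemeasurable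
  have hre : ∀ x y : EuclideanSpace ℂ (Fin N), inner ℝ x y = (inner ℂ x y).re := fun x y => by
    simp [PiLp.inner_apply, Complex.inner]
  refine Measure.ext_of_charFun (funext fun t => ?_)
  rw [charFun_apply, integral_map hU.aemeasurable (by fun_prop)]
  have h : ∀ x, inner ℝ (U x) t = inner ℝ x (U.symm t) := fun x => by
    rw [hre, hre, ← U.inner_map_map x, U.apply_symm_apply]
  simp only [h]
  rw [← charFun_apply, charFun_rayleighLaw, charFun_rayleighLaw, U.symm.norm_map]

/-- Any two unit vectors are exchanged up to a phase by a unitary map preserving every subspace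
that contains both. -/
lemma exists_unitary_map_eq_smul {N : ℕ} {u v : EuclideanSpace ℂ (Fin N)} (hu : ‖u‖ = 1)
    (hv : ‖v‖ = 1) :
    ∃ (U : EuclideanSpace ℂ (Fin N) ≃ₗᵢ[ℂ] EuclideanSpace ℂ (Fin N)) (a : ℂ), ‖a‖ = 1 ∧
      U u = a • v ∧
      ∀ S : Submodule ℂ (EuclideanSpace ℂ (Fin N)), u ∈ S → v ∈ S → ∀ x, U x ∈ S ↔ x ∈ S := by
  -- The phase `a` makes the inner product of `u` and `a • v` real, as the orthogonality of their
  -- sum and difference requires.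
  obtain ⟨a, ha, hau⟩ : ∃ a : ℂ, ‖a‖ = 1 ∧ inner ℂ u (a • v) = (‖inner ℂ u v‖ : ℂ) := by
    by_cases h : inner ℂ u v = 0
    · exact ⟨1, by simp, by simp [h]⟩
    · have hn : (‖inner ℂ u v‖ : ℂ) ≠ 0 := by exact_mod_cast norm_ne_zero_iff.2 h
      refine ⟨(‖inner ℂ u v‖ : ℂ) / inner ℂ u v, ?_, ?_⟩
      · rw [norm_div]
        simp [h]
      · rw [inner_smul_right, div_mul_cancel₀ _ h]
  set w := a • v with hw
  have hwn : ‖w‖ = 1 := by rw [hw, norm_smul, ha, hv, one_mul]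
  have hwu : inner ℂ w u = inner ℂ u w := by
    rw [← inner_conj_symm, hau, Complex.conj_ofReal]
  have huu : inner ℂ u u = 1 := by rw [inner_self_eq_norm_sq_to_K, hu]; simp
  have hww : inner ℂ w w = 1 := by rw [inner_self_eq_norm_sq_to_K, hwn]; simp
  -- Equal norms and a real inner product put `u + w` in `K`. The reflection in `K` thus fixes `u +
  -- w`, negates `u - w`, and sends `u` to `w`.
  set K := (ℂ ∙ (u - w))ᗮ
  have h1 : K.reflection (u - w) = -(u - w) :=
    Submodule.reflection_orthogonalComplement_singleton_eq_neg _
  have h2 : K.reflection (u + w) = u + w := by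
    rw [Submodule.reflection_eq_self_iff, Submodule.mem_orthogonal_singleton_iff_inner_right]
    simp only [inner_sub_left, inner_add_right, huu, hww, hwu]
    ring
  have h3 : K.reflection u = w := by
    have h4 : u = (2⁻¹ : ℂ) • ((u - w) + (u + w)) := by module
    have h5 : w = (2⁻¹ : ℂ) • (-(u - w) + (u + w)) := by module
    refine (congrArg K.reflection h4).trans ?_
    rw [map_smul, map_add, h1, h2, ← h5]
  refine ⟨K.reflection, a, ha, h3, fun S huS hvS => ?_⟩
  -- The reflection moves every `x` by a multiple of `u - w`, which lies in `S`.
  have hsub : ∀ x, K.reflection x - x ∈ S := fun x => by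
    have hle : (ℂ ∙ (u - w)) ≤ S :=
      (Submodule.span_singleton_le_iff_mem _ _).2 (S.sub_mem huS (S.smul_mem a hvS))
    rw [Submodule.reflection_apply, Submodule.starProjection_orthogonal_val]
    have : 2 • (x - (ℂ ∙ (u - w)).starProjection x) - x - x =
      -(2 • (ℂ ∙ (u - w)).starProjection x) := by module
    rw [this]
    exact S.neg_mem (S.nsmul_mem (hle (Submodule.starProjection_apply_mem _ _)) 2)
  intro x
  constructor
  · intro h
    have := S.sub_mem h (hsub x)
    rwa [sub_sub_cancel] at this
  · intro h
    have := S.add_mem (hsub x) h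
    rwa [sub_add_cancel] at this

/-- A unitary map that preserves `S` takes `u` to `v` up to a phase, and the phase disappears in the
modulus. -/
lemma IsIsotropicIn.measure_normSq_inner_eq {N : ℕ} {μ : Measure (EuclideanSpace ℂ (Fin N))}
    {S : Submodule ℂ (EuclideanSpace ℂ (Fin N))} (hμ : IsIsotropicIn μ S)
    {u v : EuclideanSpace ℂ (Fin N)} (huS : u ∈ S) (hvS : v ∈ S) (hu : ‖u‖ = 1) (hv : ‖v‖ = 1)
    (t : ℝ) :
    μ {x | t < ‖inner ℂ u x‖ ^ 2} = μ {x | t < ‖inner ℂ v x‖ ^ 2} := by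
  obtain ⟨U, a, ha, hU, hS⟩ := exists_unitary_map_eq_smul hu hv
  have h : μ {x | t < ‖inner ℂ v x‖ ^ 2} = μ.map U {x | t < ‖inner ℂ v x‖ ^ 2} := by
    rw [hμ.invariant U (hS S huS hvS)]
  rw [h, Measure.map_apply U.continuous.measurable
    (measurableSet_lt measurable_const (by fun_prop))]
  congr 1
  ext x
  have h2 : ‖inner ℂ v (U x)‖ = ‖inner ℂ u x‖ := by
    rw [← U.inner_map_map u x, hU, inner_smul_left, norm_mul, RCLike.norm_conj, ha, one_mul]
  simp only [Set.mem_ofPred_eq, Set.preimage_ofPred_eq, h2]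

lemma measure_rayleighLaw_eq (N : ℕ) {u v : EuclideanSpace ℂ (Fin N)}
    (hu : ‖u‖ = 1) (hv : ‖v‖ = 1) (t : ℝ) :
    rayleighLaw N {g | t * ‖g‖ ^ 2 < ‖inner ℂ g u‖ ^ 2} =
      rayleighLaw N {g | t * ‖g‖ ^ 2 < ‖inner ℂ g v‖ ^ 2} := by
  obtain ⟨U, a, ha, hU, -⟩ := exists_unitary_map_eq_smul hu hv
  have h : rayleighLaw N {g | t * ‖g‖ ^ 2 < ‖inner ℂ g v‖ ^ 2} =
      (rayleighLaw N).map U {g | t * ‖g‖ ^ 2 < ‖inner ℂ g v‖ ^ 2} := by rw [map_rayleighLaw]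
  rw [h, Measure.map_apply U.continuous.measurable
    (measurableSet_lt (by fun_prop) (by fun_prop))]
  congr 1
  ext g
  have h2 : ‖inner ℂ (U g) v‖ = ‖inner ℂ g u‖ := by
    rw [← U.inner_map_map g u, hU, inner_smul_right, norm_mul, ha, one_mul]
  simp only [Set.mem_ofPred_eq, Set.preimage_ofPred_eq, h2, U.norm_map]

/-! ### The Beta law of a squared projection. -/

lemma lintegral_exp_neg_erlangMeasure_zero {s : ℝ} (hs : 0 ≤ s) :
    ∫⁻ u, ENNReal.ofReal (Real.exp (-(s * u))) ∂erlangMeasure 0 = ENNReal.ofReal (1 / (1 + s)) := by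
  rw [lintegral_erlangMeasure _ (by fun_prop)]
  have h : ∀ u : ℝ, ENNReal.ofReal (u ^ 0 * Real.exp (-u) / (Nat.factorial 0 : ℕ)) *
      ENNReal.ofReal (Real.exp (-(s * u))) = ENNReal.ofReal (Real.exp (-(1 + s) * u)) := fun u => by
    rw [← ENNReal.ofReal_mul (by positivity)]
    congr 1
    simp only [pow_zero, one_mul, Nat.factorial_zero, Nat.cast_one, div_one]
    rw [← Real.exp_add]
    congr 1
    ring
  simp only [h]
  rw [← ofReal_integral_eq_lintegral_ofReal (integrableOn_exp_mul_Ioi (by linarith) 0)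
    (Filter.Eventually.of_forall fun _ => (Real.exp_pos _).le),
    integral_exp_mul_Ioi (by linarith)]
  congr 1
  rw [mul_zero, Real.exp_zero, neg_div_neg_eq]

lemma erlangMeasure_zero_Ioi {c : ℝ} (hc : 0 ≤ c) :
    erlangMeasure 0 (Set.Ioi c) = ENNReal.ofReal (Real.exp (-c)) := by
  rw [erlangMeasure, withDensity_apply _ measurableSet_Ioi,
    Measure.restrict_restrict measurableSet_Ioi, Set.Ioi_inter_Ioi, max_eq_left hc]
  have h : ∀ u : ℝ, ENNReal.ofReal (u ^ 0 * Real.exp (-u) / (Nat.factorial 0 : ℕ)) =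
      ENNReal.ofReal (Real.exp (-u)) := fun u => by simp
  simp only [h]
  rw [← ofReal_integral_eq_lintegral_ofReal (integrableOn_exp_neg_Ioi c)
    (Filter.Eventually.of_forall fun _ => (Real.exp_pos _).le), integral_exp_neg_Ioi]

lemma ae_pos_erlangMeasure (n : ℕ) : ∀ᵐ u ∂erlangMeasure n, 0 < u :=
  (withDensity_absolutelyContinuous _ _).ae_le (ae_restrict_mem measurableSet_Ioi)

lemma lintegral_prod_exp_pi (n : ℕ) {s : ℝ} (hs : 0 ≤ s) :
    ∫⁻ y : Fin n → ℝ, ENNReal.ofReal (Real.exp (-(s * ∑ i, y i)))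
      ∂(Measure.pi fun _ : Fin n => erlangMeasure 0) = ENNReal.ofReal ((1 / (1 + s)) ^ n) := by
  induction n with
  | zero => simp
  | succ n ih =>
    have h := measurePreserving_piFinSuccAbove (fun _ : Fin (n + 1) => erlangMeasure 0) 0
    have hs' : ∀ x : Fin (n + 1) → ℝ, ENNReal.ofReal (Real.exp (-(s * ∑ i, x i))) =
        (fun p : ℝ × (Fin n → ℝ) => ENNReal.ofReal (Real.exp (-(s * p.1))) *
          ENNReal.ofReal (Real.exp (-(s * ∑ i, p.2 i))))
        (MeasurableEquiv.piFinSuccAbove (fun _ => ℝ) 0 x) := by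
      intro x
      simp only [MeasurableEquiv.piFinSuccAbove_apply, Fin.insertNthEquiv_symm_apply]
      rw [← ENNReal.ofReal_mul (Real.exp_pos _).le, ← Real.exp_add, Fin.sum_univ_succ]
      congr 2
      simp [Fin.removeNth]
      ring
    refine (lintegral_congr hs').trans ?_
    rw [h.lintegral_comp (f := fun p : ℝ × (Fin n → ℝ) => ENNReal.ofReal (Real.exp (-(s * p.1))) *
          ENNReal.ofReal (Real.exp (-(s * ∑ i, p.2 i)))) (by fun_prop),
      lintegral_prod_mul (f := fun x : ℝ => ENNReal.ofReal (Real.exp (-(s * x))))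
        (g := fun y : Fin n → ℝ => ENNReal.ofReal (Real.exp (-(s * ∑ i, y i))))
        (by fun_prop) (by fun_prop),
      lintegral_exp_neg_erlangMeasure_zero hs, ih, ← ENNReal.ofReal_mul (by positivity), pow_succ']

/-- Given that the other coordinates sum to `σ`, the event is `x 0 > s * σ` with `s = t / (1 - t)`,
of probability `exp (-s * σ)`. Averaging over `σ` is a Laplace transform at `s`, and `1 / (1 + s) =
1 - t`. -/
lemma pi_erlangMeasure_lt (n : ℕ) {t : ℝ} (ht0 : 0 ≤ t) (ht1 : t < 1) :
    (Measure.pi fun _ : Fin (n + 1) => erlangMeasure 0) {x | t * ∑ i, x i < x 0} =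
      ENNReal.ofReal ((1 - t) ^ n) := by
  have h := measurePreserving_piFinSuccAbove (fun _ : Fin (n + 1) => erlangMeasure 0) 0
  have hs : {x : Fin (n + 1) → ℝ | t * ∑ i, x i < x 0} =
      (MeasurableEquiv.piFinSuccAbove (fun _ => ℝ) 0) ⁻¹'
        {p : ℝ × (Fin n → ℝ) | t * (p.1 + ∑ i, p.2 i) < p.1} := by
    ext x
    simp [Fin.sum_univ_succ, Fin.tail]
  have hmeas : MeasurableSet {p : ℝ × (Fin n → ℝ) | t * (p.1 + ∑ i, p.2 i) < p.1} :=
    measurableSet_lt (by fun_prop) (by fun_prop)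
  have h1t : 0 < 1 - t := sub_pos.2 ht1
  rw [hs, h.measure_preimage hmeas.nullMeasurableSet, Measure.prod_apply_symm hmeas]
  have hpos : ∀ᵐ y ∂(Measure.pi fun _ : Fin n => erlangMeasure 0), ∀ i, 0 < y i := by
    rw [ae_all_iff]
    intro i
    exact (measurePreserving_eval (fun _ : Fin n => erlangMeasure 0) i).quasiMeasurePreserving.ae
      (ae_pos_erlangMeasure 0)
  have hcongr : ∀ᵐ y ∂(Measure.pi fun _ : Fin n => erlangMeasure 0),
      erlangMeasure 0 ((fun s => (s, y)) ⁻¹'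
        {p : ℝ × (Fin n → ℝ) | t * (p.1 + ∑ i, p.2 i) < p.1}) =
      ENNReal.ofReal (Real.exp (-(t / (1 - t) * ∑ i, y i))) := by
    filter_upwards [hpos] with y hy
    have hsum : 0 ≤ ∑ i, y i := Finset.sum_nonneg fun i _ => (hy i).le
    rw [← erlangMeasure_zero_Ioi (by positivity)]
    congr 1
    ext s
    simp only [Set.mem_preimage, Set.mem_ofPred_eq, Set.mem_Ioi]
    rw [div_mul_eq_mul_div, div_lt_iff₀ h1t]
    constructor <;> intro _ <;> linarith
  rw [lintegral_congr_ae hcongr, lintegral_prod_exp_pi n (by positivity)]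
  congr 2
  field_simp
  ring

/-- By unitary invariance `v` may be taken to be a basis vector; the squared moduli of the entries
are independent exponentials. -/
lemma rayleighLaw_lt (n : ℕ) {v : EuclideanSpace ℂ (Fin (n + 1))} (hv : ‖v‖ = 1) {t : ℝ}
    (ht0 : 0 ≤ t) (ht1 : t < 1) :
    rayleighLaw (n + 1) {g | t * ‖g‖ ^ 2 < ‖inner ℂ g v‖ ^ 2} = ENNReal.ofReal ((1 - t) ^ n) := by
  rw [measure_rayleighLaw_eq (n + 1) hv (v := EuclideanSpace.single 0 1) (by simp) t,
    ← pi_erlangMeasure_lt n ht0 ht1, ← map_normSq_pi_stdComplexGaussian, rayleighLaw,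
    Measure.map_apply (WithLp.measurable_toLp 2 _) (measurableSet_lt (by fun_prop) (by fun_prop)),
    Measure.map_apply (by fun_prop) (measurableSet_lt (by fun_prop) (by fun_prop))]
  congr 1
  ext x
  simp [EuclideanSpace.norm_sq_eq, EuclideanSpace.inner_single_right]

/-- The squared modulus of the projection of an isotropic unit vector of an `n + 1`-dimensional
space on a fixed direction of that space has a `Beta(1, n)` law. -/
theorem IsIsotropicIn.measure_lt_normSq_inner {N n : ℕ} {μ : Measure (EuclideanSpace ℂ (Fin N))}
    {S : Submodule ℂ (EuclideanSpace ℂ (Fin N))} (hμ : IsIsotropicIn μ S)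
    (hn : Module.finrank ℂ S = n + 1) {v : EuclideanSpace ℂ (Fin N)} (hvS : v ∈ S) (hv : ‖v‖ = 1)
    {t : ℝ} (ht0 : 0 ≤ t) (ht1 : t < 1) :
    μ {x | t < ‖inner ℂ v x‖ ^ 2} = ENNReal.ofReal ((1 - t) ^ n) := by
  have := hμ.isProbabilityMeasure
  obtain ⟨T⟩ : Nonempty (EuclideanSpace ℂ (Fin (n + 1)) ≃ₗᵢ[ℂ] S) :=
    ⟨((stdOrthonormalBasis ℂ S).reindex (finCongr hn)).repr.symm⟩
  set L : EuclideanSpace ℂ (Fin (n + 1)) →ₗᵢ[ℂ] EuclideanSpace ℂ (Fin N) :=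
    S.subtypeₗᵢ.comp T.toLinearIsometry with hL
  have hLS : ∀ g, L g ∈ S := fun g => (T g).2
  have hLT : ∀ x (hx : x ∈ S), L (T.symm ⟨x, hx⟩) = x := fun x hx =>
    congrArg Subtype.val (T.apply_symm_apply ⟨x, hx⟩)
  have hTc : Continuous L := L.continuous
  set A : Set (EuclideanSpace ℂ (Fin (n + 1)) × EuclideanSpace ℂ (Fin N)) :=
    {p | t * ‖p.1‖ ^ 2 < ‖inner ℂ (L p.1) p.2‖ ^ 2} with hA
  have hAm : MeasurableSet A := by
    refine measurableSet_lt (by fun_prop) (Continuous.measurable ?_)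
    exact ((hTc.comp continuous_fst).inner continuous_snd).norm.pow 2
  -- Tonelli evaluates the measure of `A` in two ways. For fixed `g`, isotropy makes the section as
  -- likely as the event in question; for fixed `x`, the section is the Gaussian event of
  -- `rayleighLaw_lt`.
  have e1 := Measure.prod_apply (μ := rayleighLaw (n + 1)) (ν := μ) hAm
  rw [Measure.prod_apply_symm hAm] at e1
  have hne : ∀ᵐ g ∂rayleighLaw (n + 1), 0 < ‖g‖ ^ 2 := by
    have := ae_pos_erlangMeasure n
    rw [← map_normSq_rayleighLaw] at this
    exact ae_of_ae_map (by fun_prop) this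
  have e2 : ∀ᵐ g ∂rayleighLaw (n + 1), μ (Prod.mk g ⁻¹' A) = μ {x | t < ‖inner ℂ v x‖ ^ 2} := by
    filter_upwards [hne] with g hg
    have hg0 : 0 < ‖g‖ := by
      rcases (norm_nonneg g).eq_or_lt with h | h
      · rw [← h] at hg; simp at hg
      · exact h
    have hcn : ‖((‖g‖ : ℂ))⁻¹‖ = ‖g‖⁻¹ := by simp
    have hu : ‖((‖g‖ : ℂ))⁻¹ • (L g)‖ = 1 := by
      rw [norm_smul, hcn, L.norm_map, inv_mul_cancel₀ hg0.ne']
    rw [← hμ.measure_normSq_inner_eq (S.smul_mem _ (hLS g)) hvS hu hv t]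
    congr 1
    ext x
    simp only [hA, Set.mem_preimage, Set.mem_ofPred_eq]
    rw [inner_smul_left, norm_mul, RCLike.norm_conj, hcn, mul_pow, inv_pow,
      inv_mul_eq_div, lt_div_iff₀ hg]
  have e3 : ∀ᵐ x ∂μ, rayleighLaw (n + 1) ((fun g => (g, x)) ⁻¹' A) =
      ENNReal.ofReal ((1 - t) ^ n) := by
    filter_upwards [hμ.mem_sphere] with x hx
    have hw : ‖T.symm ⟨x, hx.1⟩‖ = 1 := by rw [T.symm.norm_map]; exact hx.2
    rw [← rayleighLaw_lt n hw ht0 ht1]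
    congr 1
    ext g
    have : inner ℂ g (T.symm ⟨x, hx.1⟩) = inner ℂ (L g) x := by
      rw [← L.inner_map_map, hLT]
    simp only [hA, Set.mem_preimage, Set.mem_ofPred_eq, this]
  rw [lintegral_congr_ae e2, lintegral_congr_ae e3] at e1
  simpa using e1.symm

lemma norm_direction {N : ℕ} {h : EuclideanSpace ℂ (Fin N)} (hh : h ≠ 0) : ‖direction h‖ = 1 := by
  rw [direction, norm_smul, Complex.norm_real, norm_inv, norm_norm,
    inv_mul_cancel₀ (norm_ne_zero_iff.2 hh)]

lemma measurable_direction {N : ℕ} : Measurable (direction (N := N)) := by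
  unfold direction
  fun_prop

lemma ae_ne_zero_rayleighLaw (n : ℕ) : ∀ᵐ g ∂rayleighLaw (n + 1), g ≠ 0 := by
  have := ae_pos_erlangMeasure n
  rw [← map_normSq_rayleighLaw] at this
  filter_upwards [ae_of_ae_map (by fun_prop) this] with g hg h0
  simp [h0] at hg

instance (n : ℕ) : IsProbabilityMeasure (erlangMeasure n) := by
  rw [← map_normSq_rayleighLaw]
  exact Measure.isProbabilityMeasure_map (by fun_prop)

/-- What matters later is that this value is positive: it keeps the row scalings of `csiMatrix`
nonzero. -/
lemma avgGain_succ (n : ℕ) : avgGain (n + 1) = n + 1 := by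
  have h1 : avgGain (n + 1) = ∫ u, u ∂erlangMeasure n := by
    rw [← map_normSq_rayleighLaw, integral_map (by fun_prop) (by fun_prop)]
    rfl
  have h2 : ∫⁻ u, ENNReal.ofReal u ∂erlangMeasure n = ENNReal.ofReal (n + 1) := by
    -- The total mass of the next Erlang law serves as the Gamma integral: `u` times the density of
    -- shape `n + 1` is `n + 1` times the density of shape `n + 2`.
    have h3 := lintegral_erlangMeasure (n + 1) (f := fun _ => 1) measurable_const
    rw [lintegral_one, measure_univ] at h3
    rw [lintegral_erlangMeasure _ (by fun_prop), ← mul_one (ENNReal.ofReal (n + 1)), h3,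
      ← lintegral_const_mul _ (by fun_prop)]
    refine setLIntegral_congr_fun measurableSet_Ioi fun u hu => ?_
    have hu' : (0 : ℝ) < u := hu
    simp only [mul_one]
    rw [← ENNReal.ofReal_mul (by positivity), ← ENNReal.ofReal_mul (by positivity)]
    congr 1
    rw [Nat.factorial_succ]
    push_cast
    field_simp
    ring
  rw [h1, integral_eq_lintegral_of_nonneg_ae ((ae_pos_erlangMeasure n).mono fun _ h => h.le)
    (by fun_prop), h2, ENNReal.toReal_ofReal (by positivity)]

/-! ### The quantization error -/

/-- The law of the minimum of `M` independent `Beta(n, 1)` variables. -/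
noncomputable def minBetaMeasure (n M : ℕ) : Measure ℝ :=
  (volume.restrict (Set.Ioc 0 1)).withDensity
    fun z => ENNReal.ofReal (M * (1 - z ^ n) ^ (M - 1) * (n * z ^ (n - 1)))

lemma minBeta_density_nonneg (n M : ℕ) {z : ℝ} (h0 : 0 ≤ z) (h1 : z ≤ 1) :
    0 ≤ M * (1 - z ^ n) ^ (M - 1) * (n * z ^ (n - 1)) := by
  have := sub_nonneg.2 (pow_le_one₀ (n := n) h0 h1)
  positivity

lemma lintegral_minBetaMeasure (n M : ℕ) {f : ℝ → ENNReal} (hf : Measurable f) :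
    ∫⁻ z, f z ∂minBetaMeasure n M =
      ∫⁻ z in Set.Ioc 0 1,
        ENNReal.ofReal (M * (1 - z ^ n) ^ (M - 1) * (n * z ^ (n - 1))) * f z := by
  rw [minBetaMeasure, lintegral_withDensity_eq_lintegral_mul _ (by fun_prop) hf]
  rfl

lemma hasDerivAt_neg_one_sub_pow_pow (n M : ℕ) (z : ℝ) :
    HasDerivAt (fun z : ℝ => -(1 - z ^ n) ^ M)
      (M * (1 - z ^ n) ^ (M - 1) * (n * z ^ (n - 1))) z := by
  refine (((hasDerivAt_pow n z).const_sub 1).fun_pow M).fun_neg.congr_deriv ?_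
  ring

/-- The integrand is the derivative of `-(1 - z ^ n) ^ M`, which vanishes at `z = 1` because `M ≠
0`. -/
lemma minBetaMeasure_Ici (n : ℕ) {M : ℕ} (hM : M ≠ 0) {a : ℝ} (h0 : 0 ≤ a) (h1 : a ≤ 1) :
    ∫⁻ z in Set.Ioc a 1, ENNReal.ofReal (M * (1 - z ^ n) ^ (M - 1) * (n * z ^ (n - 1))) =
      ENNReal.ofReal ((1 - a ^ n) ^ M) := by
  rw [← ofReal_integral_eq_lintegral_ofReal
      (by fun_prop : Continuous fun z : ℝ =>
        M * (1 - z ^ n) ^ (M - 1) * (n * z ^ (n - 1))).integrableOn_Ioc,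
    ← intervalIntegral.integral_of_le h1, intervalIntegral.integral_eq_sub_of_hasDerivAt
      (fun z _ => hasDerivAt_neg_one_sub_pow_pow n M z)
      ((by fun_prop : Continuous fun z : ℝ =>
        M * (1 - z ^ n) ^ (M - 1) * (n * z ^ (n - 1))).intervalIntegrable a 1)]
  · simp [hM]
  · filter_upwards [ae_restrict_mem measurableSet_Ioc] with z hz
    exact minBeta_density_nonneg n M (h0.trans hz.1.le) hz.2

/-- The error is at least `z` exactly when every codeword has squared projection at most `1 - z`.
Given `h`, these events are independent, each of probability `1 - z ^ n` by the Beta law at `t = 1 -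
z`. -/
lemma IsRVQ.measure_le_sinSqAngle {Ω : Type*} [MeasurableSpace Ω] {P : Measure Ω}
    [IsProbabilityMeasure P] {n B : ℕ} {h : Ω → EuclideanSpace ℂ (Fin (n + 1))}
    {c : Fin (2 ^ B) → Ω → EuclideanSpace ℂ (Fin (n + 1))}
    {q : Ω → EuclideanSpace ℂ (Fin (n + 1))} (hq : IsRVQ P h c q) {z : ℝ} (h0 : 0 < z)
    (h1 : z ≤ 1) :
    P {ω | z ≤ sinSqAngle (h ω) (q ω)} = ENNReal.ofReal ((1 - z ^ n) ^ (2 ^ B)) := by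
  set A : Set (EuclideanSpace ℂ (Fin (n + 1)) × (Fin (2 ^ B) → EuclideanSpace ℂ (Fin (n + 1)))) :=
    {p | ∀ i, ‖inner ℂ (direction p.1) (p.2 i)‖ ^ 2 ≤ 1 - z} with hA
  have hdir := measurable_direction (N := n + 1)
  have hAm : MeasurableSet A := by
    rw [hA, Set.ofPred_forall]
    exact MeasurableSet.iInter fun i => measurableSet_le
      (((hdir.comp measurable_fst).inner
        ((measurable_pi_apply i).comp measurable_snd)).norm.pow_const 2)
      measurable_const
  have hc : AEMeasurable (fun ω i => c i ω) P := aemeasurable_pi_lambda _ hq.codeword_aemeasurable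
  have e1 : P {ω | z ≤ sinSqAngle (h ω) (q ω)} = P ((fun ω => (h ω, fun i => c i ω)) ⁻¹' A) := by
    refine measure_congr ?_
    filter_upwards [hq.selection] with ω hω
    refine propext ?_
    obtain ⟨⟨i, hi⟩, hmax⟩ := hω
    change z ≤ 1 - _ ↔ ∀ i, _
    constructor
    · intro hz i
      have := pow_le_pow_left₀ (norm_nonneg _) (hmax i) 2
      simp only
      linarith
    · intro hall
      have := hall i
      rw [hi]
      simp only at this
      linarith
  have hlaw : P.map (fun ω => (h ω, fun i => c i ω)) =
      (rayleighLaw (n + 1)).prod (Measure.pi fun i => P.map (c i)) := by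
    rw [(indepFun_iff_map_prod_eq_prod_map_map hq.channel_law.aemeasurable hc).1 hq.channel_indep,
      hq.channel_law.map_eq,
      (iIndepFun_iff_map_fun_eq_pi_map hq.codeword_aemeasurable).1 hq.codebook_indep]
  have hcp : ∀ i, IsProbabilityMeasure (P.map (c i)) := fun i =>
    (hq.codeword_isotropic i).isProbabilityMeasure
  rw [e1, ← Measure.map_apply_of_aemeasurable (hq.channel_law.aemeasurable.prodMk hc) hAm, hlaw,
    Measure.prod_apply hAm]
  have e2 : ∀ᵐ g ∂rayleighLaw (n + 1), (Measure.pi fun i => P.map (c i)) (Prod.mk g ⁻¹' A) =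
      ENNReal.ofReal ((1 - z ^ n) ^ (2 ^ B)) := by
    filter_upwards [ae_ne_zero_rayleighLaw n] with g hg
    have hset : Prod.mk g ⁻¹' A = Set.univ.pi fun _ : Fin (2 ^ B) =>
        {x : EuclideanSpace ℂ (Fin (n + 1)) | 1 - z < ‖inner ℂ (direction g) x‖ ^ 2}ᶜ := by
      ext x
      simp [hA, Set.mem_pi]
    rw [hset, Measure.pi_pi]
    have hone : ∀ i, P.map (c i)
        {x : EuclideanSpace ℂ (Fin (n + 1)) | 1 - z < ‖inner ℂ (direction g) x‖ ^ 2}ᶜ =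
        ENNReal.ofReal (1 - z ^ n) := fun i => by
      rw [prob_compl_eq_one_sub (measurableSet_lt measurable_const (by fun_prop)),
        (hq.codeword_isotropic i).measure_lt_normSq_inner (n := n) (by simp) (Submodule.mem_top)
          (norm_direction hg) (by linarith) (by linarith), sub_sub_cancel,
        ENNReal.ofReal_sub _ (by positivity), ENNReal.ofReal_one]
    simp only [hone, Finset.prod_const, Finset.card_univ, Fintype.card_fin]
    rw [ENNReal.ofReal_pow (sub_nonneg.2 (pow_le_one₀ h0.le h1))]
  rw [lintegral_congr_ae e2]
  simp

/-- The quantization error of random vector quantization is the minimum of `2 ^ B` independent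
`Beta(N - 1, 1)` variables. -/
theorem IsRVQ.map_sinSqAngle {Ω : Type*} [MeasurableSpace Ω] {P : Measure Ω}
    [IsProbabilityMeasure P] {n B : ℕ} (hn : n ≠ 0) {h : Ω → EuclideanSpace ℂ (Fin (n + 1))}
    {c : Fin (2 ^ B) → Ω → EuclideanSpace ℂ (Fin (n + 1))}
    {q : Ω → EuclideanSpace ℂ (Fin (n + 1))} (hq : IsRVQ P h c q)
    (hm : AEMeasurable (fun ω => sinSqAngle (h ω) (q ω)) P) :
    P.map (fun ω => sinSqAngle (h ω) (q ω)) = minBetaMeasure n (2 ^ B) := by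
  have := Measure.isProbabilityMeasure_map hm
  have hval : ∀ a : ℝ, minBetaMeasure n (2 ^ B) (Set.Ici a) = ∫⁻ z in Set.Ici a ∩ Set.Ioc 0 1,
      ENNReal.ofReal ((2 ^ B : ℕ) * (1 - z ^ n) ^ (2 ^ B - 1) * (n * z ^ (n - 1))) := fun a => by
    rw [minBetaMeasure, withDensity_apply _ measurableSet_Ici,
      Measure.restrict_restrict measurableSet_Ici]
  have h01 : ∀ᵐ ω ∂P, 0 ≤ sinSqAngle (h ω) (q ω) := by
    have hne : ∀ᵐ ω ∂P, h ω ≠ 0 := by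
      have := ae_ne_zero_rayleighLaw n
      rw [← hq.channel_law.map_eq] at this
      exact ae_of_ae_map hq.channel_law.aemeasurable this
    have hcn : ∀ᵐ ω ∂P, ∀ i, ‖c i ω‖ = 1 := ae_all_iff.2 fun i =>
      (ae_of_ae_map (hq.codeword_aemeasurable i) (hq.codeword_isotropic i).mem_sphere).mono
        fun _ h => h.2
    filter_upwards [hne, hcn, hq.selection] with ω hne hcn hsel
    obtain ⟨i, hi⟩ := hsel.1
    have := norm_inner_le_norm (𝕜 := ℂ) (direction (h ω)) (q ω)
    rw [norm_direction hne, hi, hcn i, one_mul] at this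
    rw [sinSqAngle, sub_nonneg, hi]
    exact pow_le_one₀ (norm_nonneg _) this
  -- The tail formula covers `0 < a ≤ 1`; elsewhere the error lying in `[0, 1]` suffices, with `n ≠
  -- 0` giving total mass one when `a ≤ 0`.
  refine Measure.ext_of_Ici _ _ fun a => ?_
  rw [hval, Measure.map_apply_of_aemeasurable hm measurableSet_Ici]
  rcases le_or_gt a 0 with ha | ha
  · have hset : Set.Ici a ∩ Set.Ioc 0 1 = Set.Ioc 0 1 :=
      Set.inter_eq_right.2 fun x hx => ha.trans hx.1.le
    have h1 : P ((fun ω => sinSqAngle (h ω) (q ω)) ⁻¹' Set.Ici a) = 1 := by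
      refine le_antisymm prob_le_one ?_
      rw [← measure_univ (μ := P)]
      exact measure_mono_ae (h01.mono fun ω hω _ => ha.trans hω)
    rw [hset, minBetaMeasure_Ici n (by positivity) le_rfl zero_le_one, h1]
    simp [hn]
  · rcases le_or_gt a 1 with ha1 | ha1
    · have hset : Set.Ici a ∩ Set.Ioc 0 1 = Set.Icc a 1 := by
        ext x
        simp only [Set.mem_inter_iff, Set.mem_Ici, Set.mem_Ioc, Set.mem_Icc]
        exact ⟨fun h => ⟨h.1, h.2.2⟩, fun h => ⟨h.1, ha.trans_le h.1, h.2⟩⟩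
      rw [hset, ← restrict_Ioc_eq_restrict_Icc, minBetaMeasure_Ici n (by positivity) ha.le ha1]
      exact hq.measure_le_sinSqAngle ha ha1
    · have hset : Set.Ici a ∩ Set.Ioc 0 1 = ∅ := by
        ext x
        simp only [Set.mem_inter_iff, Set.mem_Ici, Set.mem_Ioc, Set.mem_empty_iff_false, iff_false]
        intro h
        linarith [h.1, h.2.2]
      have hset2 : (fun ω => sinSqAngle (h ω) (q ω)) ⁻¹' Set.Ici a = ∅ := by
        ext ω
        simp only [Set.mem_preimage, Set.mem_Ici, Set.mem_empty_iff_false, iff_false, not_le,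
          sinSqAngle]
        have := sq_nonneg ‖inner ℂ (direction (h ω)) (q ω)‖
        linarith
      rw [hset, hset2]
      simp

/-! ### The zero-forcing vector -/

/-- `M * X` and `M * Y` are orthogonal projections with the same range, hence equal; likewise `X *
M` and `Y * M` have the same kernel. These products determine `X = X * M * X`. -/
lemma IsMoorePenrose.eq {m n : Type*} [Fintype m] [Fintype n] {M : Matrix m n ℂ}
    {X Y : Matrix n m ℂ} (hX : IsMoorePenrose M X) (hY : IsMoorePenrose M Y) : X = Y := by
  have h1 : M * X = M * Y := by
    calc M * X = (M * X)ᴴ := hX.left_herm.symm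
      _ = (M * Y * (M * X))ᴴ := by rw [← Matrix.mul_assoc, hY.mul_mul_self]
      _ = M * X * (M * Y) := by rw [Matrix.conjTranspose_mul, hX.left_herm, hY.left_herm]
      _ = M * Y := by rw [← Matrix.mul_assoc, hX.mul_mul_self]
  have h2 : X * M = Y * M := by
    calc X * M = (X * M)ᴴ := hX.right_herm.symm
      _ = (X * M * (Y * M))ᴴ := by
        rw [Matrix.mul_assoc X, ← Matrix.mul_assoc M, hY.mul_mul_self]
      _ = Y * M * (X * M) := by rw [Matrix.conjTranspose_mul, hX.right_herm, hY.right_herm]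
      _ = Y * M := by rw [Matrix.mul_assoc Y, ← Matrix.mul_assoc M, hX.mul_mul_self]
  calc X = X * M * X := hX.mul_mul_inv.symm
    _ = Y * M * Y := by rw [h2, Matrix.mul_assoc, h1, ← Matrix.mul_assoc]
    _ = Y := hY.mul_mul_inv

lemma IsMoorePenrose.pinv_eq {m n : Type*} [Fintype m] [Fintype n] {M : Matrix m n ℂ}
    {X : Matrix n m ℂ} (hX : IsMoorePenrose M X) : pinv M = X := by
  have hM : ∃ X, IsMoorePenrose M X := ⟨X, hX⟩
  rw [pinv, dif_pos hM]
  exact hM.choose_spec.eq hX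

open scoped ComplexOrder in
lemma isUnit_det_mul_conjTranspose {m n : Type*} [Fintype m] [Fintype n] [DecidableEq m]
    {M : Matrix m n ℂ} (hM : LinearIndependent ℂ M.row) : IsUnit (M * Mᴴ).det :=
  (Matrix.isUnit_iff_isUnit_det _).1
    (Matrix.PosDef.mul_conjTranspose_self M (Matrix.vecMul_injective_iff.2 hM)).isUnit

/-- Independent rows make the Gram matrix `M * Mᴴ` invertible. The resulting formula gives access to
`pinv`, which is defined by choice. -/
lemma isMoorePenrose_of_linearIndependent {m n : Type*} [Fintype m] [Fintype n] [DecidableEq m]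
    {M : Matrix m n ℂ} (hM : LinearIndependent ℂ M.row) :
    M * (Mᴴ * (M * Mᴴ)⁻¹) = 1 ∧ IsMoorePenrose M (Mᴴ * (M * Mᴴ)⁻¹) := by
  have h1 : M * (Mᴴ * (M * Mᴴ)⁻¹) = 1 := by
    rw [← Matrix.mul_assoc, Matrix.mul_nonsing_inv _ (isUnit_det_mul_conjTranspose hM)]
  refine ⟨h1, ?_, ?_, ?_, ?_⟩
  · rw [h1, Matrix.one_mul]
  · rw [Matrix.mul_assoc, h1, Matrix.mul_one]
  · rw [h1, Matrix.conjTranspose_one]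
  · simp only [Matrix.conjTranspose_mul, Matrix.conjTranspose_nonsing_inv,
      Matrix.conjTranspose_conjTranspose, Matrix.mul_assoc]

/-- The zero-forcing vector, computed with the right inverse `Mᴴ (M Mᴴ)⁻¹` of the CSI matrix. -/
noncomputable def rightInverseZF {N K : ℕ} (ξ : Fin K → ℝ) (H : Fin K → EuclideanSpace ℂ (Fin N))
    (k : Fin K) : EuclideanSpace ℂ (Fin N) :=
  direction (WithLp.toLp 2
    (((csiMatrix ξ H)ᴴ * (csiMatrix ξ H * (csiMatrix ξ H)ᴴ)⁻¹).col k))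

/-- The inverse is written with determinant and adjugate, which are continuous in `H`; this also
covers dependent rows. -/
lemma measurable_rightInverseZF {N K : ℕ} (ξ : Fin K → ℝ) (k : Fin K) :
    Measurable fun H : Fin K → EuclideanSpace ℂ (Fin N) => rightInverseZF ξ H k := by
  have hM : Continuous fun H : Fin K → EuclideanSpace ℂ (Fin N) => csiMatrix ξ H := by
    unfold csiMatrix
    fun_prop
  refine measurable_direction.comp ((WithLp.measurable_toLp 2 _).comp
    (measurable_pi_lambda _ fun n => ?_))
  have hG : Continuous fun H : Fin K → EuclideanSpace ℂ (Fin N) =>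
    csiMatrix ξ H * (csiMatrix ξ H)ᴴ := hM.matrix_mul hM.matrix_conjTranspose
  simp only [Matrix.col_apply, Matrix.mul_apply, Matrix.inv_def, Ring.inverse_eq_inv',
    Matrix.smul_apply, smul_eq_mul]
  refine Finset.measurable_sum _ fun i _ => ?_
  refine Measurable.mul ?_ (Measurable.mul (hG.matrix_det.measurable.inv) ?_)
  · exact (hM.matrix_conjTranspose.matrix_elem n i).measurable
  · exact (hG.matrix_adjugate.matrix_elem i k).measurable

/-- Uniqueness of the pseudo-inverse gives the first claim. The others are entries of `M * X = 1`:
the diagonal one excludes a zero column, the off-diagonal ones are the zero-forcing conditions. -/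
lemma zfVector_properties {n K : ℕ} {ξ : Fin K → ℝ} (hξ : ∀ i, 0 < ξ i)
    {H : Fin K → EuclideanSpace ℂ (Fin (n + 1))} (hH : LinearIndependent ℂ H) (k : Fin K) :
    zfVector ξ H k = rightInverseZF ξ H k ∧ ‖rightInverseZF ξ H k‖ = 1 ∧
      ∀ j, k ≠ j → ∑ i, H j i * rightInverseZF ξ H k i = 0 := by
  set M := csiMatrix ξ H with hM
  have ha : ∀ i, ((ξ i * √(avgGain (n + 1)) : ℝ) : ℂ) ≠ 0 := fun i => by
    rw [avgGain_succ]
    have := hξ i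
    exact_mod_cast (by positivity : ξ i * √((n : ℝ) + 1) ≠ 0)
  have hrow : LinearIndependent ℂ M.row := by
    have h1 : LinearIndependent ℂ fun i => (H i).ofLp :=
      hH.map' (WithLp.linearEquiv 2 ℂ (Fin (n + 1) → ℂ)).toLinearMap (LinearEquiv.ker _)
    have h2 := h1.units_smul fun i => Units.mk0 _ (ha i)
    exact h2
  obtain ⟨hMX, hMP⟩ := isMoorePenrose_of_linearIndependent hrow
  set X := Mᴴ * (M * Mᴴ)⁻¹ with hX
  have hmul : ∀ j, ((ξ j * √(avgGain (n + 1)) : ℝ) : ℂ) * ∑ i, H j i * X i k =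
      (1 : Matrix (Fin K) (Fin K) ℂ) j k := fun j => by
    rw [← hMX, Matrix.mul_apply, Finset.mul_sum]
    simp only [hM, csiMatrix, Matrix.of_apply, mul_assoc]
  refine ⟨?_, ?_, fun j hjk => ?_⟩
  · rw [zfVector, rightInverseZF, ← hM, ← hX, hMP.pinv_eq]
  · refine norm_direction fun h0 => ?_
    have := hmul k
    have hz : ∀ i, X i k = 0 := fun i => congrArg (fun v : EuclideanSpace ℂ (Fin (n + 1)) => v i) h0
    simp [hz] at this
  · have h0 := hmul j
    rw [Matrix.one_apply_ne hjk.symm] at h0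
    have h1 := (mul_eq_zero.1 h0).resolve_left (ha j)
    simp only [rightInverseZF, direction, ← hM, ← hX, PiLp.smul_apply, Matrix.col_apply,
      smul_eq_mul, mul_left_comm _ (Complex.ofReal _), ← Finset.mul_sum, h1, mul_zero]

/-! ### Incomplete Gamma integrals -/

lemma integrableOn_pow_mul_exp_neg (k : ℕ) {d : ℝ} (hd : 0 ≤ d) :
    IntegrableOn (fun a : ℝ => a ^ k * Real.exp (-a)) (Set.Ioi d) := by
  have h := Real.GammaIntegral_convergent (s := k + 1) (by positivity)
  refine (h.congr_fun (fun a _ => ?_) measurableSet_Ioi).mono_set (Set.Ioi_subset_Ioi hd)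
  simp only [add_sub_cancel_right, Real.rpow_natCast, mul_comm]

lemma integrableOn_inv_pow_mul_exp_neg (p : ℕ) {d : ℝ} (hd : 0 < d) :
    IntegrableOn (fun a : ℝ => (a ^ p)⁻¹ * Real.exp (-a)) (Set.Ioi d) := by
  refine Integrable.mono' ((integrableOn_exp_neg_Ioi d).const_mul (d ^ p)⁻¹) (by fun_prop) ?_
  filter_upwards [ae_restrict_mem measurableSet_Ioi] with a ha
  have ha' : d < a := ha
  have : 0 < a := hd.trans ha'
  rw [Real.norm_of_nonneg (by positivity)]
  gcongr

lemma integral_pow_mul_exp_neg_succ (k : ℕ) {d : ℝ} (hd : 0 ≤ d) :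
    ∫ a in Set.Ioi d, a ^ (k + 1) * Real.exp (-a) =
      d ^ (k + 1) * Real.exp (-d) + (k + 1) * ∫ a in Set.Ioi d, a ^ k * Real.exp (-a) := by
  have hi := (integrableOn_pow_mul_exp_neg (k + 1) hd)
  have hj := (integrableOn_pow_mul_exp_neg k hd).const_mul ((k : ℝ) + 1)
  have key := integral_Ioi_of_hasDerivAt_of_tendsto (a := d) (m := 0)
    (f := fun a : ℝ => -(a ^ (k + 1) * Real.exp (-a)))
    (f' := fun a => a ^ (k + 1) * Real.exp (-a) - ((k : ℝ) + 1) * (a ^ k * Real.exp (-a)))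
    (by fun_prop) (fun a _ => by
      refine ((hasDerivAt_pow (k + 1) a).mul (hasDerivAt_neg a).exp).neg.congr_deriv ?_
      simp only [Nat.add_sub_cancel]
      push_cast
      ring) (hi.sub hj)
    (by simpa using (Real.tendsto_pow_mul_exp_neg_atTop_nhds_zero (k + 1)).neg)
  rw [integral_sub hi hj, integral_const_mul] at key
  linarith

lemma integral_pow_mul_exp_neg (k : ℕ) {d : ℝ} (hd : 0 ≤ d) :
    ∫ a in Set.Ioi d, a ^ k * Real.exp (-a) =
      Real.exp (-d) * ∑ l ∈ Finset.range (k + 1), (l.factorial : ℝ) * k.choose l * d ^ (k - l) := by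
  induction k with
  | zero => simpa using integral_exp_neg_Ioi d
  | succ k ih =>
    rw [integral_pow_mul_exp_neg_succ k hd, ih, Finset.sum_range_succ' _ (k + 1)]
    have : ∀ l ∈ Finset.range (k + 1), ((l + 1).factorial : ℝ) * (k + 1).choose (l + 1) *
        d ^ (k + 1 - (l + 1)) = (k + 1) * ((l.factorial : ℝ) * k.choose l * d ^ (k - l)) := by
      intro l _
      have h := Nat.add_one_mul_choose_eq k l
      have h' : ((k : ℝ) + 1) * k.choose l = (k + 1).choose (l + 1) * (l + 1) := by exact_mod_cast h
      rw [Nat.factorial_succ, Nat.add_sub_add_right]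
      push_cast
      linear_combination -(l.factorial : ℝ) * d ^ (k - l) * h'
    rw [Finset.sum_congr rfl this, ← Finset.mul_sum]
    simp
    ring

/-- Integration by parts with `-(a ^ p)⁻¹ * exp (-a)`; iterated, it lowers the inverse power to the
first, where the integral is `E₁`. -/
lemma integral_inv_pow_mul_exp_neg_succ {p : ℕ} (hp : p ≠ 0) {d : ℝ} (hd : 0 < d) :
    p * ∫ a in Set.Ioi d, (a ^ (p + 1))⁻¹ * Real.exp (-a) =
      (d ^ p)⁻¹ * Real.exp (-d) - ∫ a in Set.Ioi d, (a ^ p)⁻¹ * Real.exp (-a) := by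
  have hi := integrableOn_inv_pow_mul_exp_neg p hd
  have hj := (integrableOn_inv_pow_mul_exp_neg (p + 1) hd).const_mul (p : ℝ)
  have hlim : Filter.Tendsto (fun a : ℝ => -((a ^ p)⁻¹ * Real.exp (-a))) Filter.atTop (nhds 0) := by
    have h1 : Filter.Tendsto (fun a : ℝ => (a ^ p)⁻¹) Filter.atTop (nhds 0) :=
      (Filter.tendsto_pow_atTop hp).inv_tendsto_atTop
    simpa using (h1.mul (Real.tendsto_exp_neg_atTop_nhds_zero)).neg
  have hder : ∀ a : ℝ, 0 < a → HasDerivAt (fun a : ℝ => -((a ^ p)⁻¹ * Real.exp (-a)))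
      (p * ((a ^ (p + 1))⁻¹ * Real.exp (-a)) + (a ^ p)⁻¹ * Real.exp (-a)) a := fun a ha => by
    refine (((hasDerivAt_pow p a).fun_inv (by positivity)).mul
      (hasDerivAt_neg a).exp).neg.congr_deriv ?_
    obtain ⟨m, rfl⟩ := Nat.exists_eq_succ_of_ne_zero hp
    simp only [Nat.succ_eq_add_one, add_tsub_cancel_right]
    field_simp
    ring
  have key := integral_Ioi_of_hasDerivAt_of_tendsto
    (hder d hd).continuousAt.continuousWithinAt (fun a ha => hder a (hd.trans ha)) (hj.add hi) hlim
  rw [integral_add hj hi, integral_const_mul] at key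
  linarith

/-- Scaled by `d ^ (k + 1)`, the recursion reads `J (k + 1) = d / (k + 1) * (exp (-d) - J k)`,
starting from `J 0 = d * E₁(d)`. The denominators are the falling factorials `k! / (k - l - 1)!`. -/
lemma pow_mul_integral_inv_pow_mul_exp_neg (k : ℕ) {d : ℝ} (hd : 0 < d) :
    d ^ (k + 1) * ∫ a in Set.Ioi d, (a ^ (k + 1))⁻¹ * Real.exp (-a) =
      Real.exp (-d) * ∑ l ∈ Finset.range k,
        (-1) ^ l * d ^ (l + 1) / (((l + 1).factorial : ℝ) * k.choose (l + 1)) +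
      expIntegralE1 d * ((-1) ^ k * d ^ (k + 1) / k.factorial) := by
  induction k with
  | zero =>
    simp only [expIntegralE1, div_eq_inv_mul]
    simp [mul_comm]
  | succ k ih =>
    have hrec := integral_inv_pow_mul_exp_neg_succ (p := k + 1) (by simp) hd
    have hk : ((k : ℝ) + 1) ≠ 0 := by positivity
    have hd0 : d ^ (k + 1) ≠ 0 := by positivity
    have h1 : d ^ (k + 1 + 1) * ∫ a in Set.Ioi d, (a ^ (k + 1 + 1))⁻¹ * Real.exp (-a) =
        d / (k + 1) * (Real.exp (-d) -
          d ^ (k + 1) * ∫ a in Set.Ioi d, (a ^ (k + 1))⁻¹ * Real.exp (-a)) := by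
      push_cast at hrec
      have h2 : ∫ a in Set.Ioi d, (a ^ (k + 1 + 1))⁻¹ * Real.exp (-a) =
        ((d ^ (k + 1))⁻¹ * Real.exp (-d) -
          ∫ a in Set.Ioi d, (a ^ (k + 1))⁻¹ * Real.exp (-a)) / (k + 1) := by
        rw [← hrec]
        field_simp
      rw [h2]
      generalize ∫ a in Set.Ioi d, (a ^ (k + 1))⁻¹ * Real.exp (-a) = J
      rw [pow_succ d (k + 1)]
      field_simp
    have hsum : ∀ l ∈ Finset.range k, (-1 : ℝ) ^ (l + 1) * d ^ (l + 1 + 1) /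
        (((l + 1 + 1).factorial : ℝ) * (k + 1).choose (l + 1 + 1)) =
        -(d / (k + 1)) * ((-1) ^ l * d ^ (l + 1) /
          (((l + 1).factorial : ℝ) * k.choose (l + 1))) := by
      intro l hl
      have h := Nat.add_one_mul_choose_eq k (l + 1)
      have h' : ((k : ℝ) + 1) * k.choose (l + 1) = (k + 1).choose (l + 1 + 1) * (l + 1 + 1) := by
        exact_mod_cast h
      have hden : (((l + 1 + 1).factorial : ℝ) * (k + 1).choose (l + 1 + 1)) =
          (k + 1) * (((l + 1).factorial : ℝ) * k.choose (l + 1)) := by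
        rw [Nat.factorial_succ (l + 1)]
        push_cast
        linear_combination -((l + 1).factorial : ℝ) * h'
      have hc : (k.choose (l + 1) : ℝ) ≠ 0 := by
        exact_mod_cast (Nat.choose_pos (Finset.mem_range.1 hl)).ne'
      rw [hden]
      field_simp
      ring
    rw [h1, ih, Finset.sum_range_succ', Finset.sum_congr rfl hsum, ← Finset.mul_sum,
      Nat.factorial_succ k]
    have hf : (k.factorial : ℝ) ≠ 0 := by positivity
    generalize ∑ l ∈ Finset.range k, (-1 : ℝ) ^ l * d ^ (l + 1) /
      (((l + 1).factorial : ℝ) * k.choose (l + 1)) = S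
    simp only [Nat.cast_mul, Nat.cast_add, Nat.cast_one, zero_add, Nat.factorial_one,
      Nat.choose_one_right, pow_zero, pow_one, one_mul]
    field_simp
    ring

/-! ### The law of a product of a quantization error and a Beta variable -/

lemma mul_one_sub_pow_eq_sum (M : ℕ) (y : ℝ) :
    ((M + 1 : ℕ) : ℝ) * (1 - y) ^ M =
      ∑ k ∈ Finset.range (M + 1), ((M + 1).choose (k + 1) : ℝ) * (-1) ^ k * (k + 1) * y ^ k := by
  rw [sub_eq_neg_add, add_pow, Finset.mul_sum]
  refine Finset.sum_congr rfl fun k _ => ?_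
  have h := Nat.add_one_mul_choose_eq M k
  have h' : ((M : ℝ) + 1) * M.choose k = (M + 1).choose (k + 1) * (k + 1) := by exact_mod_cast h
  rw [one_pow, neg_pow]
  push_cast
  linear_combination (-1) ^ k * y ^ k * h'

/-- The density of the minimum of `M + 1` independent `Beta(r + 1, 1)` variables, weighted by
the tail of a `Beta(1, r)` variable. -/
lemma minBeta_density_mul_eq_sum (M r : ℕ) {x z : ℝ} (hz : z ≠ 0) :
    ((M + 1 : ℕ) : ℝ) * (1 - z ^ (r + 1)) ^ M * ((r + 1 : ℕ) * z ^ r) * (1 - x / z) ^ r =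
      ∑ n ∈ Finset.range (r + 1), ∑ k ∈ Finset.range (M + 1),
        (r.choose n : ℝ) * (M + 1).choose (k + 1) * (-1) ^ (n + k) * (k + 1) * (r + 1) * x ^ n *
          z ^ (k * (r + 1) + (r - n)) := by
  rw [mul_one_sub_pow_eq_sum, sub_eq_neg_add, add_pow, mul_comm, Finset.sum_mul]
  refine Finset.sum_congr rfl fun n hn => ?_
  rw [Finset.sum_mul, Finset.mul_sum]
  refine Finset.sum_congr rfl fun k _ => ?_
  have hnr : n ≤ r := Nat.lt_succ_iff.1 (Finset.mem_range.1 hn)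
  have hzr : z ^ r = z ^ n * z ^ (r - n) := by rw [← pow_add, Nat.add_sub_cancel' hnr]
  rw [one_pow, neg_pow, div_pow, pow_add z (k * (r + 1)), ← pow_mul,
    mul_comm (r + 1) k, hzr]
  push_cast
  field_simp
  ring

/-- The tail at `x ∈ (0, 1]` of the product of the minimum of `M` independent `Beta(r + 1, 1)`
variables with an independent `Beta(1, r)` variable. -/
noncomputable def productTail (M r : ℕ) (x : ℝ) : ℝ :=
  ∑ n ∈ Finset.range (r + 1), ∑ k ∈ Finset.range M,
    (r.choose n : ℝ) * M.choose (k + 1) * (-1) ^ (n + k) * (k + 1) * (r + 1) /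
      ((k + 1) * (r + 1) - n) * (x ^ n - x ^ ((k + 1) * (r + 1)))

/-- Termwise integration: as `n ≤ r`, every exponent of `z` is nonnegative, so no logarithm appears
and the denominators `(k + 1) * (r + 1) - n` are positive. -/
lemma integral_minBeta_density_mul (M r : ℕ) {x : ℝ} (h0 : 0 < x) (h1 : x ≤ 1) :
    ∫ z in x..1, ((M + 1 : ℕ) : ℝ) * (1 - z ^ (r + 1)) ^ M * ((r + 1 : ℕ) * z ^ r) *
      (1 - x / z) ^ r = productTail (M + 1) r x := by
  have hcongr : Set.EqOn (fun z => ((M + 1 : ℕ) : ℝ) * (1 - z ^ (r + 1)) ^ M *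
      ((r + 1 : ℕ) * z ^ r) * (1 - x / z) ^ r) (fun z =>
      ∑ n ∈ Finset.range (r + 1), ∑ k ∈ Finset.range (M + 1),
        (r.choose n : ℝ) * (M + 1).choose (k + 1) * (-1) ^ (n + k) * (k + 1) * (r + 1) * x ^ n *
          z ^ (k * (r + 1) + (r - n))) (Set.uIcc x 1) := fun z hz => by
    rw [Set.uIcc_of_le h1] at hz
    exact minBeta_density_mul_eq_sum M r (h0.trans_le hz.1).ne'
  rw [intervalIntegral.integral_congr hcongr, intervalIntegral.integral_finsetSum
    (fun n _ => Continuous.intervalIntegrable (by fun_prop) _ _)]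
  refine Finset.sum_congr rfl fun n hn => ?_
  rw [intervalIntegral.integral_finsetSum
    (fun n _ => Continuous.intervalIntegrable (by fun_prop) _ _)]
  refine Finset.sum_congr rfl fun k _ => ?_
  have hnr : n ≤ r := Nat.lt_succ_iff.1 (Finset.mem_range.1 hn)
  obtain ⟨s, rfl⟩ := Nat.exists_eq_add_of_le hnr
  rw [intervalIntegral.integral_const_mul, integral_pow]
  have hden : ((k : ℝ) + 1) * (((n + s : ℕ) : ℝ) + 1) - n = k * (n + s + 1) + s + 1 := by
    push_cast; ring
  have hpos : (0 : ℝ) < k * (n + s + 1) + s + 1 := by positivity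
  have hx : x ^ ((k + 1) * (n + s + 1)) = x ^ n * x ^ (k * (n + s + 1) + s + 1) := by
    rw [← pow_add]; congr 1; ring
  rw [hden, hx, one_pow, Nat.add_sub_cancel_left]
  push_cast
  field_simp

lemma productTail_nonneg (M r : ℕ) {x : ℝ} (h0 : 0 < x) (h1 : x ≤ 1) :
    0 ≤ productTail (M + 1) r x := by
  rw [← integral_minBeta_density_mul M r h0 h1]
  refine intervalIntegral.integral_nonneg h1 fun z hz => mul_nonneg ?_ ?_
  · simpa using minBeta_density_nonneg (r + 1) (M + 1) (h0.le.trans hz.1) hz.2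
  · exact pow_nonneg (sub_nonneg.2 ((div_le_one (h0.trans_le hz.1)).2 hz.1)) r

lemma ae_mem_Ioc_minBetaMeasure (n M : ℕ) : ∀ᵐ z ∂minBetaMeasure n M, z ∈ Set.Ioc (0 : ℝ) 1 :=
  (withDensity_absolutelyContinuous _ _).ae_le (ae_restrict_mem measurableSet_Ioc)

lemma measurable_measure_Ioi (ρ : Measure ℝ) : Measurable fun t => ρ (Set.Ioi t) :=
  Antitone.measurable fun _ _ h => measure_mono (Set.Ioi_subset_Ioi h)

/-- `ρ` has the tail of a `Beta(1, r)` law. -/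
def HasBetaOneTail (ρ : Measure ℝ) (r : ℕ) : Prop :=
  (∀ t, 0 ≤ t → t < 1 → ρ (Set.Ioi t) = ENNReal.ofReal ((1 - t) ^ r)) ∧ ρ (Set.Ioi 1) = 0

lemma HasBetaOneTail.eq_zero {ρ : Measure ℝ} {r : ℕ} (hρ : HasBetaOneTail ρ r) {t : ℝ}
    (ht : 1 ≤ t) : ρ (Set.Ioi t) = 0 :=
  measure_mono_null (Set.Ioi_subset_Ioi ht) hρ.2

/-- Conditioning on `z` turns `z * w > x` into `w > x / z`, which is null unless `z > x`; the
integral is thereby cut down to `x < z ≤ 1`. -/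
lemma HasBetaOneTail.lintegral_minBetaMeasure {ρ : Measure ℝ} {r : ℕ} (hρ : HasBetaOneTail ρ r)
    (M : ℕ) {x : ℝ} (h0 : 0 < x) :
    ∫⁻ z, ρ (Set.Ioi (x / z)) ∂minBetaMeasure (r + 1) (M + 1) =
      if x < 1 then ENNReal.ofReal (productTail (M + 1) r x) else 0 := by
  split_ifs with h1
  · rw [_root_.lintegral_minBetaMeasure _ _ (f := fun z => ρ (Set.Ioi (x / z)))
        ((measurable_measure_Ioi ρ).comp (measurable_const.div measurable_id)),
      ← integral_minBeta_density_mul M r h0 h1.le, intervalIntegral.integral_of_le h1.le,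
      ofReal_integral_eq_lintegral_ofReal, ← lintegral_indicator measurableSet_Ioc,
      ← lintegral_indicator measurableSet_Ioc]
    · congr 1
      ext z
      by_cases hz : z ∈ Set.Ioc x 1
      · have hz0 : 0 < z := h0.trans hz.1
        rw [Set.indicator_of_mem hz, Set.indicator_of_mem (show z ∈ Set.Ioc 0 1 from ⟨hz0, hz.2⟩),
          hρ.1 _ (by positivity) ((div_lt_one hz0).2 hz.1),
          ← ENNReal.ofReal_mul (minBeta_density_nonneg _ _ hz0.le hz.2)]
        simp
      · rw [Set.indicator_of_notMem hz]
        by_cases hz' : z ∈ Set.Ioc (0 : ℝ) 1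
        · have hzx : z ≤ x := not_lt.1 fun h => hz ⟨h, hz'.2⟩
          rw [Set.indicator_of_mem hz', hρ.eq_zero ((one_le_div hz'.1).2 hzx), mul_zero]
        · rw [Set.indicator_of_notMem hz']
    · refine (intervalIntegrable_iff_integrableOn_Ioc_of_le h1.le).1 ?_
      refine ContinuousOn.intervalIntegrable ?_
      rw [Set.uIcc_of_le h1.le]
      have : ∀ z ∈ Set.Icc x 1, z ≠ 0 := fun z hz => (h0.trans_le hz.1).ne'
      fun_prop (disch := assumption)
    · filter_upwards [ae_restrict_mem measurableSet_Ioc] with z hz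
      have hz0 : 0 < z := h0.trans hz.1
      refine mul_nonneg ?_ (pow_nonneg (sub_nonneg.2 ((div_le_one hz0).2 hz.1.le)) r)
      simpa using minBeta_density_nonneg (r + 1) (M + 1) hz0.le hz.2
  · rw [lintegral_congr_ae (g := fun _ => 0), lintegral_zero]
    filter_upwards [ae_mem_Ioc_minBetaMeasure (r + 1) (M + 1)] with z hz
    exact hρ.eq_zero ((one_le_div hz.1).2 (hz.2.trans (not_lt.1 h1)))

/-! ### Averaging the tail over the Erlang gain. -/

/-- At `x = d / a` the two monomials of `productTail` turn `a ^ (r + 1)` into a nonnegative power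
and the inverse of `a ^ (k * (r + 1))`. The factor `r + 1` reduces `(r + 1)!` to the `(N - 2)!` of
the theorem. -/
lemma erlang_density_mul_productTail (M r : ℕ) {d a : ℝ} (ha : a ≠ 0) :
    a ^ (r + 1) * Real.exp (-a) / (r + 1).factorial * productTail M r (d / a) =
      ∑ n ∈ Finset.range (r + 1), ∑ k ∈ Finset.range M,
        (r.choose n : ℝ) * M.choose (k + 1) * (-1) ^ (n + k) * (k + 1) /
          ((k + 1) * (r + 1) - n) / r.factorial *
          (d ^ n * (a ^ (r + 1 - n) * Real.exp (-a)) -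
            d ^ ((k + 1) * (r + 1)) * ((a ^ (k * (r + 1)))⁻¹ * Real.exp (-a))) := by
  rw [productTail, Finset.mul_sum]
  refine Finset.sum_congr rfl fun n hn => ?_
  rw [Finset.mul_sum]
  refine Finset.sum_congr rfl fun k _ => ?_
  have hnr : n ≤ r := Nat.lt_succ_iff.1 (Finset.mem_range.1 hn)
  have e1 : a ^ (r + 1) * (d / a) ^ n = d ^ n * a ^ (r + 1 - n) := by
    have : a ^ (r + 1) = a ^ (r + 1 - n) * a ^ n := by
      rw [← pow_add, Nat.sub_add_cancel (hnr.trans (Nat.le_succ r))]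
    rw [div_pow, this]
    field_simp
  have e2 : a ^ (r + 1) * (d / a) ^ ((k + 1) * (r + 1)) =
      d ^ ((k + 1) * (r + 1)) * (a ^ (k * (r + 1)))⁻¹ := by
    have : a ^ ((k + 1) * (r + 1)) = a ^ (r + 1) * a ^ (k * (r + 1)) := by
      rw [← pow_add]; congr 1; ring
    rw [div_pow, this]
    field_simp
  have hf : ((r + 1).factorial : ℝ) = (r + 1) * r.factorial := by
    rw [Nat.factorial_succ]; push_cast; ring
  have hr : ((r : ℝ) + 1) ≠ 0 := by positivity
  have e3 : ((r : ℝ) + 1) / ((r + 1) * r.factorial) = 1 / r.factorial := by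
    field_simp
  rw [hf]
  set c := (r.choose n : ℝ) * M.choose (k + 1) * (-1) ^ (n + k) * (k + 1) with hc
  set q := ((k : ℝ) + 1) * (r + 1) - n with hq
  calc _ = c / q * (((r : ℝ) + 1) / ((r + 1) * r.factorial)) * Real.exp (-a) *
        (a ^ (r + 1) * (d / a) ^ n - a ^ (r + 1) * (d / a) ^ ((k + 1) * (r + 1))) := by ring
    _ = _ := by rw [e1, e2, e3]; ring

lemma integrableOn_productTail_term (r n p : ℕ) (b c : ℝ) {d : ℝ} (hd : 0 < d) (q : ℝ) :
    IntegrableOn (fun a : ℝ => q * (b * (a ^ (r + 1 - n) * Real.exp (-a)) -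
      c * ((a ^ p)⁻¹ * Real.exp (-a)))) (Set.Ioi d) :=
  (((integrableOn_pow_mul_exp_neg _ hd.le).const_mul _).sub
    ((integrableOn_inv_pow_mul_exp_neg _ hd).const_mul _)).const_mul _

lemma integrableOn_erlang_density_mul_productTail (M r : ℕ) {d : ℝ} (hd : 0 < d) :
    IntegrableOn (fun a => a ^ (r + 1) * Real.exp (-a) / (r + 1).factorial *
      productTail M r (d / a)) (Set.Ioi d) := by
  refine IntegrableOn.congr_fun (f := fun a => _) ?_ (fun a ha =>
    (erlang_density_mul_productTail M r (hd.trans ha).ne').symm) measurableSet_Ioi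
  exact integrable_finsetSum _ fun n _ => integrable_finsetSum _ fun k _ =>
    integrableOn_productTail_term r n _ _ _ hd _

lemma integral_erlang_density_mul_productTail (M r : ℕ) {d : ℝ} (hd : 0 < d) :
    ∫ a in Set.Ioi d, a ^ (r + 1) * Real.exp (-a) / (r + 1).factorial * productTail M r (d / a) =
      ∑ n ∈ Finset.range (r + 1), ∑ k ∈ Finset.range M,
        (r.choose n : ℝ) * M.choose (k + 1) * (-1) ^ (n + k) * (k + 1) /
          ((k + 1) * (r + 1) - n) / r.factorial *
          (d ^ n * (∫ a in Set.Ioi d, a ^ (r + 1 - n) * Real.exp (-a)) -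
            d ^ ((k + 1) * (r + 1)) *
              ∫ a in Set.Ioi d, (a ^ (k * (r + 1)))⁻¹ * Real.exp (-a)) := by
  rw [setIntegral_congr_fun measurableSet_Ioi fun a (ha : d < a) =>
    erlang_density_mul_productTail M r (hd.trans ha).ne']
  rw [integral_finsetSum _ fun n _ => integrable_finsetSum _ fun k _ =>
    integrableOn_productTail_term r n _ _ _ hd _]
  refine Finset.sum_congr rfl fun n _ => ?_
  rw [integral_finsetSum _ fun k _ => integrableOn_productTail_term r n _ _ _ hd _]
  refine Finset.sum_congr rfl fun k _ => ?_
  rw [integral_const_mul, integral_sub ((integrableOn_pow_mul_exp_neg _ hd.le).const_mul _)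
    ((integrableOn_inv_pow_mul_exp_neg _ hd).const_mul _), integral_const_mul, integral_const_mul]

lemma sum_Icc_zero {β : Type*} [AddCommMonoid β] (f : ℕ → β) (k : ℕ) :
    ∑ l ∈ Finset.Icc 0 k, f l = ∑ l ∈ Finset.range (k + 1), f l := by
  congr 1
  ext; simp

lemma sum_Icc_one {β : Type*} [AddCommMonoid β] (f : ℕ → β) (k : ℕ) :
    ∑ l ∈ Finset.Icc 1 k, f l = ∑ l ∈ Finset.range k, f (l + 1) := by
  rw [Finset.range_eq_Ico, Finset.sum_Ico_add' f 0 k 1]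
  rfl

lemma sum_Icc_two {β : Type*} [AddCommMonoid β] (f : ℕ → β) (k : ℕ) :
    ∑ l ∈ Finset.Icc 2 (k + 1), f l = ∑ l ∈ Finset.range k, f (l + 2) := by
  rw [Finset.range_eq_Ico, Finset.sum_Ico_add' f 0 k 2]
  rfl

/-- The closed form of the distribution function of the product of an Erlang variable, the minimum
of `M + 1` independent `Beta(r + 1, 1)` variables and a `Beta(1, r)` variable. -/
lemma one_sub_integral_erlang_density_mul_productTail (M r : ℕ) {d : ℝ} (hd : 0 < d) :
    1 - ∫ a in Set.Ioi d,
        a ^ (r + 1) * Real.exp (-a) / (r + 1).factorial * productTail (M + 1) r (d / a) =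
      1 + Real.exp (-d) / (r + 2 - 2).factorial *
          (∑ n ∈ Finset.Icc 0 (r + 2 - 2), ∑ m ∈ Finset.Icc 1 (M + 1),
            ((r + 2 - 2).choose n : ℝ) * ((M + 1).choose m : ℝ) *
              ((-1) ^ (n + m) * m / ((m : ℝ) * (r + 2 : ℕ) - (m + n))) *
              ∑ l ∈ Finset.Icc 0 (r + 2 - 1 - n),
                (l.factorial : ℝ) * ((r + 2 - 1 - n).choose l : ℝ) * d ^ (r + 2 - 1 - l))
        - Real.exp (-d) / (r + 2 - 2).factorial *
          (∑ n ∈ Finset.Icc 0 (r + 2 - 2),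
            ((r + 2 - 2).choose n : ℝ) * ((M + 1).choose 1 : ℝ) *
              ((-1) ^ (n + 1) / (((r + 2 : ℕ) : ℝ) - 1 - n)) * d ^ (r + 2 - 1))
        - Real.exp (-d) / (r + 2 - 2).factorial *
          (∑ n ∈ Finset.Icc 0 (r + 2 - 2), ∑ m ∈ Finset.Icc 2 (M + 1),
            ((r + 2 - 2).choose n : ℝ) * ((M + 1).choose m : ℝ) *
              ((-1) ^ (n + m) * m / ((m : ℝ) * (r + 2 : ℕ) - (m + n))) *
              ∑ l ∈ Finset.Icc 1 ((m - 1) * (r + 2 - 1) - 1),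
                (-1) ^ (l - 1) * d ^ (r + 2 - 1 + l) /
                  ((l.factorial : ℝ) * (((m - 1) * (r + 2 - 1) - 1).choose l : ℝ)))
        - expIntegralE1 d / (r + 2 - 2).factorial *
          (∑ n ∈ Finset.Icc 0 (r + 2 - 2), ∑ m ∈ Finset.Icc 2 (M + 1),
            ((r + 2 - 2).choose n : ℝ) * ((M + 1).choose m : ℝ) *
              ((-1) ^ (n + m) * m / ((m : ℝ) * (r + 2 : ℕ) - (m + n))) *
              ((-1) ^ ((m - 1) * (r + 2 - 1) - 1) * d ^ (m * (r + 2 - 1)) /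
                (((m - 1) * (r + 2 - 1) - 1).factorial : ℝ))) := by
  have hN1 : r + 2 - 1 = r + 1 := rfl
  have hN2 : r + 2 - 2 = r := rfl
  simp only [hN1, hN2]
  set c : ℕ → ℕ → ℝ := fun n m => (r.choose n : ℝ) * ((M + 1).choose m : ℝ) *
    ((-1) ^ (n + m) * m / ((m : ℝ) * (r + 2 : ℕ) - (m + n))) with hc
  have hG : ∀ n ∈ Finset.range (r + 1),
      d ^ n * (∫ a in Set.Ioi d, a ^ (r + 1 - n) * Real.exp (-a)) =
      Real.exp (-d) * ∑ l ∈ Finset.Icc 0 (r + 1 - n),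
        (l.factorial : ℝ) * ((r + 1 - n).choose l : ℝ) * d ^ (r + 1 - l) := fun n hn => by
    rw [integral_pow_mul_exp_neg _ hd.le, sum_Icc_zero, mul_left_comm, Finset.mul_sum]
    congr 1
    refine Finset.sum_congr rfl fun l hl => ?_
    have h1 := Finset.mem_range.1 hn
    have h2 := Finset.mem_range.1 hl
    have : d ^ (r + 1 - l) = d ^ n * d ^ (r + 1 - n - l) := by
      rw [← pow_add]; congr 1; omega
    rw [this]
    ring
  -- The terms `m = k + 2`: the inverse power is at least one and leads to `E₁`, with recursion
  -- depth `p = (m - 1) * (N - 1) - 1`.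
  have hJ : ∀ k : ℕ, d ^ ((k + 2) * (r + 1)) *
      (∫ a in Set.Ioi d, (a ^ ((k + 1) * (r + 1)))⁻¹ * Real.exp (-a)) =
      Real.exp (-d) * (∑ l ∈ Finset.Icc 1 ((k + 1) * (r + 1) - 1),
        (-1) ^ (l - 1) * d ^ (r + 1 + l) /
          ((l.factorial : ℝ) * (((k + 1) * (r + 1) - 1).choose l : ℝ))) +
      expIntegralE1 d * ((-1) ^ ((k + 1) * (r + 1) - 1) * d ^ ((k + 2) * (r + 1)) /
        (((k + 1) * (r + 1) - 1).factorial : ℝ)) := fun k => by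
    obtain ⟨p, hp⟩ : ∃ p, (k + 1) * (r + 1) = p + 1 := ⟨(k + 1) * (r + 1) - 1, by
      have : 0 < (k + 1) * (r + 1) := by positivity
      omega⟩
    have hp2 : (k + 2) * (r + 1) = (r + 1) + (p + 1) := by rw [← hp]; ring
    rw [hp2, hp, pow_add, mul_assoc, pow_mul_integral_inv_pow_mul_exp_neg p hd, sum_Icc_one,
      Nat.add_sub_cancel, mul_add, mul_left_comm, Finset.mul_sum]
    congr 1
    · congr 1
      refine Finset.sum_congr rfl fun l _ => ?_
      rw [Nat.add_sub_cancel, pow_add d (r + 1) (l + 1)]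
      ring
    · ring
  -- For `m = 1` the inverse power is trivial and a pure exponential remains; hence the separate
  -- second sum of the formula.
  have hJ0 : d ^ (r + 1) * (∫ a in Set.Ioi d, (a ^ (0 * (r + 1)))⁻¹ * Real.exp (-a)) =
      Real.exp (-d) * d ^ (r + 1) := by
    simp only [zero_mul, pow_zero, inv_one, one_mul]
    rw [integral_exp_neg_Ioi, mul_comm]
  -- The minus sign comes from `m = k + 1`, as `(-1) ^ (n + k) = -(-1) ^ (n + m)`.
  have hcoef : ∀ n k : ℕ, (r.choose n : ℝ) * (M + 1).choose (k + 1) * (-1) ^ (n + k) * (k + 1) /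
      ((k + 1) * (r + 1) - n) / r.factorial = -(c n (k + 1) / r.factorial) := fun n k => by
    have hden : ((k + 1 : ℕ) : ℝ) * (r + 2 : ℕ) - ((k + 1 : ℕ) + n) = (k + 1) * (r + 1) - n := by
      push_cast; ring
    simp only [hc]
    rw [hden, ← add_assoc, pow_succ]
    push_cast
    ring
  have hc1 : ∀ n : ℕ, (r.choose n : ℝ) * ((M + 1).choose 1 : ℝ) *
      ((-1) ^ (n + 1) / (((r + 2 : ℕ) : ℝ) - 1 - n)) = c n 1 := fun n => by
    simp only [hc]
    have hden : (((r + 2 : ℕ) : ℝ) - 1 - n) = ((1 : ℕ) : ℝ) * (r + 2 : ℕ) - ((1 : ℕ) + n) := by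
      push_cast; ring
    rw [hden]
    push_cast
    ring
  have hsum : ∀ n ∈ Finset.range (r + 1), ∑ k ∈ Finset.range (M + 1),
      (r.choose n : ℝ) * (M + 1).choose (k + 1) * (-1) ^ (n + k) * (k + 1) /
          ((k + 1) * (r + 1) - n) / r.factorial *
          (d ^ n * (∫ a in Set.Ioi d, a ^ (r + 1 - n) * Real.exp (-a)) -
            d ^ ((k + 1) * (r + 1)) *
              ∫ a in Set.Ioi d, (a ^ (k * (r + 1)))⁻¹ * Real.exp (-a)) =
      -(Real.exp (-d) / r.factorial * ∑ m ∈ Finset.Icc 1 (M + 1), c n m *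
          ∑ l ∈ Finset.Icc 0 (r + 1 - n),
            (l.factorial : ℝ) * ((r + 1 - n).choose l : ℝ) * d ^ (r + 1 - l)) +
        Real.exp (-d) / r.factorial * (c n 1 * d ^ (r + 1)) +
        Real.exp (-d) / r.factorial * (∑ m ∈ Finset.Icc 2 (M + 1), c n m *
          ∑ l ∈ Finset.Icc 1 ((m - 1) * (r + 1) - 1), (-1) ^ (l - 1) * d ^ (r + 1 + l) /
            ((l.factorial : ℝ) * (((m - 1) * (r + 1) - 1).choose l : ℝ))) +
        expIntegralE1 d / r.factorial * ∑ m ∈ Finset.Icc 2 (M + 1), c n m *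
          ((-1) ^ ((m - 1) * (r + 1) - 1) * d ^ (m * (r + 1)) /
            (((m - 1) * (r + 1) - 1).factorial : ℝ)) := fun n hn => by
    simp only [hcoef, hG n hn, mul_sub]
    rw [Finset.sum_sub_distrib, Finset.sum_range_succ' (fun k => -(c n (k + 1) / r.factorial) *
      (d ^ ((k + 1) * (r + 1)) * ∫ a in Set.Ioi d, (a ^ (k * (r + 1)))⁻¹ * Real.exp (-a)))]
    simp only [zero_add, one_mul, hJ0]
    simp only [add_assoc, one_add_one_eq_two, hJ]
    rw [sum_Icc_one, sum_Icc_two, sum_Icc_two]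
    have hs : ∀ k : ℕ, k + 2 - 1 = k + 1 := fun _ => rfl
    simp only [hs, mul_add, Finset.sum_add_distrib]
    simp only [Finset.mul_sum (Finset.range (M + 1)), Finset.mul_sum (Finset.range M)]
    rw [← Finset.sum_neg_distrib]
    have e1 : ∀ k ∈ Finset.range (M + 1), -(c n (k + 1) / r.factorial) * (Real.exp (-d) *
        ∑ l ∈ Finset.Icc 0 (r + 1 - n), (l.factorial : ℝ) * ((r + 1 - n).choose l : ℝ) *
          d ^ (r + 1 - l)) = -(Real.exp (-d) / r.factorial * (c n (k + 1) *
        ∑ l ∈ Finset.Icc 0 (r + 1 - n), (l.factorial : ℝ) * ((r + 1 - n).choose l : ℝ) *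
          d ^ (r + 1 - l))) := fun k _ => by ring
    have e2 : ∀ (k : ℕ) (x y : ℝ), -(c n (k + 2) / r.factorial) * (x * y) =
      -(x / r.factorial * (c n (k + 2) * y)) := fun k x y => by ring
    rw [Finset.sum_congr rfl e1]
    simp only [e2, Finset.sum_neg_distrib]
    ring
  rw [integral_erlang_density_mul_productTail _ _ hd, Finset.sum_congr rfl hsum]
  simp only [sum_Icc_zero _ r, hc1, Finset.sum_add_distrib, Finset.mul_sum (Finset.range (r + 1)),
    Finset.sum_neg_distrib]
  ring

/-- The two other factors are at most one, so only gains `a > d` contribute. -/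
lemma HasBetaOneTail.lintegral_erlangMeasure {ρ : Measure ℝ} {r : ℕ} (hρ : HasBetaOneTail ρ r)
    (M : ℕ) {d : ℝ} (hd : 0 < d) :
    ∫⁻ a, ∫⁻ z, ρ (Set.Ioi (d / a / z)) ∂minBetaMeasure (r + 1) (M + 1) ∂erlangMeasure (r + 1) =
      ENNReal.ofReal (∫ a in Set.Ioi d, a ^ (r + 1) * Real.exp (-a) / (r + 1).factorial *
        productTail (M + 1) r (d / a)) := by
  have hmeas : Measurable fun x => productTail (M + 1) r x := by
    unfold productTail
    fun_prop
  have hcongr : ∀ᵐ a ∂erlangMeasure (r + 1),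
      ∫⁻ z, ρ (Set.Ioi (d / a / z)) ∂minBetaMeasure (r + 1) (M + 1) =
      (Set.Ioi d).indicator (fun a => ENNReal.ofReal (productTail (M + 1) r (d / a))) a := by
    filter_upwards [ae_pos_erlangMeasure (r + 1)] with a ha
    rw [hρ.lintegral_minBetaMeasure M (by positivity)]
    simp [Set.indicator_apply, div_lt_one ha]
  rw [lintegral_congr_ae hcongr, _root_.lintegral_erlangMeasure _
    (Measurable.indicator (by fun_prop) measurableSet_Ioi), ofReal_integral_eq_lintegral_ofReal
    (integrableOn_erlang_density_mul_productTail _ _ hd), ← lintegral_indicator measurableSet_Ioi,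
    ← lintegral_indicator measurableSet_Ioi]
  · congr 1
    ext a
    by_cases ha : d < a
    · have ha0 : 0 < a := hd.trans ha
      rw [Set.indicator_of_mem (Set.mem_Ioi.2 ha0), Set.indicator_of_mem (Set.mem_Ioi.2 ha),
        Set.indicator_of_mem (Set.mem_Ioi.2 ha), ← ENNReal.ofReal_mul (by positivity)]
    · rw [Set.indicator_of_notMem (s := Set.Ioi d) (by simpa using ha)]
      simp [Set.indicator_apply, ha]
  · filter_upwards [ae_restrict_mem measurableSet_Ioi] with a ha
    have ha' : d < a := ha
    have ha0 : 0 < a := hd.trans ha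
    exact mul_nonneg (by positivity)
      (productTail_nonneg M r (by positivity) ((div_le_one ha0).2 ha'.le))

lemma integral_erlang_density_mul_productTail_nonneg (M r : ℕ) {d : ℝ} (hd : 0 < d) :
    0 ≤ ∫ a in Set.Ioi d, a ^ (r + 1) * Real.exp (-a) / (r + 1).factorial *
        productTail (M + 1) r (d / a) :=
  setIntegral_nonneg measurableSet_Ioi fun a (ha : d < a) =>
    have ha0 : 0 < a := hd.trans ha
    mul_nonneg (by positivity) (productTail_nonneg M r (by positivity) ((div_le_one ha0).2 ha.le))

lemma lt_mul_mul_measure_prod {r : ℕ} {ρ : Measure ℝ} [IsProbabilityMeasure ρ]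
    (hρ : HasBetaOneTail ρ r) (M : ℕ) {d : ℝ} (hd : 0 < d) :
    ((erlangMeasure (r + 1)).prod ((minBetaMeasure (r + 1) (M + 1)).prod ρ))
        {p | d < p.1 * p.2.1 * p.2.2} =
      ENNReal.ofReal (∫ a in Set.Ioi d, a ^ (r + 1) * Real.exp (-a) / (r + 1).factorial *
        productTail (M + 1) r (d / a)) := by
  have hm : MeasurableSet {p : ℝ × ℝ × ℝ | d < p.1 * p.2.1 * p.2.2} :=
    measurableSet_lt measurable_const (by fun_prop)
  have : SFinite (minBetaMeasure (r + 1) (M + 1)) := by unfold minBetaMeasure; infer_instance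
  rw [Measure.prod_apply hm, ← hρ.lintegral_erlangMeasure M hd]
  refine lintegral_congr_ae ?_
  filter_upwards [ae_pos_erlangMeasure (r + 1)] with a ha
  rw [Measure.prod_apply (hm.preimage (by fun_prop))]
  refine lintegral_congr_ae ?_
  filter_upwards [ae_mem_Ioc_minBetaMeasure (r + 1) (M + 1)] with z hz
  congr 1
  ext w
  simp only [Set.mem_preimage, Set.mem_ofPred_eq, Set.mem_Ioi]
  rw [div_div, div_lt_iff₀ (mul_pos ha hz.1), mul_comm w]

/-! ### The leakage as a product of independent factors. -/

/-- Zero forcing removes the component along `x`; what remains is the error component, of amplitude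
`√z`. -/
lemma leakage_reconstructedDirection {N : ℕ} {a z : ℝ} (ha : 0 ≤ a) (hz : 0 ≤ z)
    {x y w : EuclideanSpace ℂ (Fin N)} (hxw : ∑ n, x n * w n = 0) :
    leakage a (reconstructedDirection z x y) w = a * z * ‖∑ n, y n * w n‖ ^ 2 := by
  have h : ∑ n, reconstructedDirection z x y n * w n = ((√z : ℝ) : ℂ) * ∑ n, y n * w n := by
    calc _ = ((√(1 - z) : ℝ) : ℂ) * (∑ n, x n * w n) + ((√z : ℝ) : ℂ) * ∑ n, y n * w n := by
          rw [Finset.mul_sum, Finset.mul_sum, ← Finset.sum_add_distrib]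
          refine Finset.sum_congr rfl fun n _ => ?_
          simp only [reconstructedDirection, PiLp.add_apply, PiLp.smul_apply, smul_eq_mul]
          ring
      _ = _ := by rw [hxw, mul_zero, zero_add]
  rw [leakage, h, norm_mul, norm_mul, Complex.norm_real, Complex.norm_real, mul_pow, mul_pow,
    Real.norm_eq_abs, Real.norm_eq_abs, sq_abs, sq_abs, Real.sq_sqrt ha, Real.sq_sqrt hz, mul_assoc]

/-- The squared modulus of the product of an isotropic unit vector of `(ℂ ∙ x)ᗮ` with a unit
column `w` such that `x w = 0` has a `Beta(1, N - 2)` law. -/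
lemma IsIsotropicIn.measure_lt_normSq_sum_mul {r : ℕ}
    {μ : Measure (EuclideanSpace ℂ (Fin (r + 2)))} {x w : EuclideanSpace ℂ (Fin (r + 2))}
    (hμ : IsIsotropicIn μ (ℂ ∙ x)ᗮ) (hx : x ≠ 0) (hw : ‖w‖ = 1) (hxw : ∑ n, x n * w n = 0) :
    (∀ t, 0 ≤ t → t < 1 →
      μ {y | t < ‖∑ n, y n * w n‖ ^ 2} = ENNReal.ofReal ((1 - t) ^ r)) ∧
    μ {y | 1 < ‖∑ n, y n * w n‖ ^ 2} = 0 := by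
  -- The row-column product is bilinear, hence the Hermitian product with the conjugate `v` of `w`;
  -- `x w = 0` then says that `v` is orthogonal to `x`.
  set v : EuclideanSpace ℂ (Fin (r + 2)) := WithLp.toLp 2 fun n => starRingEnd ℂ (w n) with hv
  have hinner : ∀ y : EuclideanSpace ℂ (Fin (r + 2)), ∑ n, y n * w n = inner ℂ v y := fun y => by
    simp [hv, PiLp.inner_apply]
  have hvn : ‖v‖ = 1 := by
    rw [← hw, EuclideanSpace.norm_eq, EuclideanSpace.norm_eq]
    simp [hv]
  have hvS : v ∈ (ℂ ∙ x)ᗮ := by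
    rw [Submodule.mem_orthogonal_singleton_iff_inner_left, ← hinner, hxw]
  have : Fact (Module.finrank ℂ (EuclideanSpace ℂ (Fin (r + 2))) = r + 1 + 1) := ⟨by simp⟩
  simp only [hinner]
  refine ⟨fun t h0 h1 => hμ.measure_lt_normSq_inner
    (Submodule.finrank_orthogonal_span_singleton hx) hvS hvn h0 h1, ?_⟩
  refine measure_mono_null (t := {y | ¬ (y ∈ (ℂ ∙ x)ᗮ ∧ ‖y‖ = 1)}) (fun y hy hS => ?_)
    hμ.mem_sphere
  have h1 := norm_inner_le_norm (𝕜 := ℂ) v y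
  rw [hvn, hS.2, one_mul] at h1
  exact absurd hy (not_lt.2 (pow_le_one₀ (norm_nonneg _) h1))

lemma measurable_normSq_sum_mul_rightInverseZF {N K : ℕ} (ξ : Fin K → ℝ) (k : Fin K) :
    Measurable fun p : (Fin K → EuclideanSpace ℂ (Fin N)) × EuclideanSpace ℂ (Fin N) =>
      ‖∑ n, p.2 n * rightInverseZF ξ p.1 k n‖ ^ 2 := by
  have hc : ∀ n, Measurable fun y : EuclideanSpace ℂ (Fin N) => y n := fun n => by fun_prop
  exact (Finset.measurable_sum _ fun n _ => ((hc n).comp measurable_snd).mul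
    ((hc n).comp ((measurable_rightInverseZF ξ k).comp measurable_fst))).norm.pow_const 2

/-- The zero-forced isotropic error vector has a `Beta(1, N - 2)` interference power. -/
lemma hasBetaOneTail_zeroForcing {Ω : Type*} [MeasurableSpace Ω] (P : Measure Ω)
    [IsProbabilityMeasure P] {r K : ℕ} {ξ : Fin K → ℝ} (hξ : ∀ i, 0 < ξ i)
    {hhat : Ω → Fin K → EuclideanSpace ℂ (Fin (r + 2))} (hhat_meas : AEMeasurable hhat P)
    (hhat_indep : ∀ᵐ ω ∂P, LinearIndependent ℂ (hhat ω)) {j k : Fin K} (hjk : k ≠ j)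
    {e : Ω → EuclideanSpace ℂ (Fin (r + 2))} (he : AEMeasurable e P)
    (he_iso : ∀ᵐ H ∂(P.map hhat), IsIsotropicIn (condDistrib e hhat P H) (ℂ ∙ H j)ᗮ) :
    HasBetaOneTail (P.map fun ω => ‖∑ n, e ω n * rightInverseZF ξ (hhat ω) k n‖ ^ 2) r := by
  have hΦm := measurable_normSq_sum_mul_rightInverseZF (N := r + 2) ξ k
  have hpair : AEMeasurable (fun ω => (hhat ω, e ω)) P := hhat_meas.prodMk he
  have hind_map : ∀ᵐ H ∂P.map hhat, LinearIndependent ℂ H :=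
    (ae_map_iff hhat_meas isOpen_setOfPred_linearIndependent.measurableSet).2 hhat_indep
  -- Disintegration over the quantized directions: for given `H` the zero-forcing vector is fixed,
  -- and the conditional tail turns out not to depend on `H`.
  have htail : ∀ t : ℝ, P.map (fun ω => ‖∑ n, e ω n * rightInverseZF ξ (hhat ω) k n‖ ^ 2)
      (Set.Ioi t) = ∫⁻ H, condDistrib e hhat P H
        {y | t < ‖∑ n, y n * rightInverseZF ξ H k n‖ ^ 2} ∂P.map hhat := fun t => by
    refine (congrArg (fun μ : Measure ℝ => μ (Set.Ioi t))
      (AEMeasurable.map_map_of_aemeasurable hΦm.aemeasurable hpair).symm).trans ?_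
    rw [Measure.map_apply hΦm measurableSet_Ioi, ← compProd_map_condDistrib he,
      Measure.compProd_apply (hΦm measurableSet_Ioi)]
    rfl
  have : IsProbabilityMeasure (P.map hhat) := Measure.isProbabilityMeasure_map hhat_meas
  have hcond : ∀ᵐ H ∂P.map hhat, (∀ t, 0 ≤ t → t < 1 → condDistrib e hhat P H
      {y | t < ‖∑ n, y n * rightInverseZF ξ H k n‖ ^ 2} = ENNReal.ofReal ((1 - t) ^ r)) ∧
      condDistrib e hhat P H {y | 1 < ‖∑ n, y n * rightInverseZF ξ H k n‖ ^ 2} = 0 := by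
    filter_upwards [he_iso, hind_map] with H hiso hind
    obtain ⟨-, h2, h3⟩ := zfVector_properties hξ hind k
    exact hiso.measure_lt_normSq_sum_mul (hind.ne_zero j) h2 (h3 j hjk)
  refine ⟨fun t h0 h1 => ?_, ?_⟩
  · rw [htail, lintegral_congr_ae (hcond.mono fun H h => h.1 t h0 h1), lintegral_const,
      measure_univ, mul_one]
  · rw [htail, lintegral_congr_ae (hcond.mono fun H h => h.2), lintegral_zero]

/-- The distribution function of a product of independent Erlang, minimum of Beta, and Beta
variables. -/
lemma cdf_map_mul_mul {Ω : Type*} [MeasurableSpace Ω] (P : Measure Ω) [IsProbabilityMeasure P]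
    {M r : ℕ} {A Z W D : Ω → ℝ} (hA : AEMeasurable A P) (hZ : AEMeasurable Z P)
    (hW : AEMeasurable W P) (hAlaw : P.map A = erlangMeasure (r + 1))
    (hZlaw : P.map Z = minBetaMeasure (r + 1) (M + 1)) (hρ : HasBetaOneTail (P.map W) r)
    (hAind : IndepFun A (fun ω => (Z ω, W ω)) P) (hZind : IndepFun Z W P)
    (hDW : D =ᵐ[P] fun ω => A ω * Z ω * W ω) :
    AEMeasurable D P ∧ (∀ d : ℝ, d ≤ 0 → cdf (P.map D) d = 0) ∧
      ∀ d : ℝ, 0 < d → cdf (P.map D) d = 1 - ∫ a in Set.Ioi d,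
        a ^ (r + 1) * Real.exp (-a) / (r + 1).factorial * productTail (M + 1) r (d / a) := by
  have hDm : AEMeasurable D P := ((hA.mul hZ).mul hW).congr hDW.symm
  have : IsProbabilityMeasure (P.map W) := Measure.isProbabilityMeasure_map hW
  have : IsProbabilityMeasure (P.map D) := Measure.isProbabilityMeasure_map hDm
  refine ⟨hDm, fun d hd => ?_, fun d hd => ?_⟩
  · have hA0 := ae_of_ae_map hA (hAlaw ▸ ae_pos_erlangMeasure (r + 1))
    have hZ0 := ae_of_ae_map hZ (hZlaw ▸ ae_mem_Ioc_minBetaMeasure (r + 1) (M + 1))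
    -- The tail at `t = 0` is `(1 - 0) ^ r = 1`.
    have hW0 : ∀ᵐ ω ∂P, 0 < W ω := by
      refine ae_of_ae_map hW ((prob_compl_eq_zero_iff measurableSet_Ioi).2 ?_)
      simpa using hρ.1 0 le_rfl one_pos
    have hD0 : ∀ᵐ ω ∂P, 0 < D ω := by
      filter_upwards [hDW, hA0, hZ0, hW0] with ω h hA0 hZ0 hW0
      rw [h]
      exact mul_pos (mul_pos hA0 hZ0.1) hW0
    have hnull : P (D ⁻¹' Set.Iic d) = 0 :=
      measure_eq_zero_iff_ae_notMem.2 (hD0.mono fun ω h hm =>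
        absurd h (not_lt.2 ((Set.mem_Iic.1 hm).trans hd)))
    rw [cdf_eq_real, measureReal_def, Measure.map_apply_of_aemeasurable hDm measurableSet_Iic,
      hnull, ENNReal.toReal_zero]
  · have hjoint : P.map (fun ω => (A ω, Z ω, W ω)) =
        (erlangMeasure (r + 1)).prod ((minBetaMeasure (r + 1) (M + 1)).prod (P.map W)) := by
      rw [(indepFun_iff_map_prod_eq_prod_map_map hA (hZ.prodMk hW)).1 hAind,
        (indepFun_iff_map_prod_eq_prod_map_map hZ hW).1 hZind, hAlaw, hZlaw]
    have htail : P.map D (Set.Ioi d) = ENNReal.ofReal (∫ a in Set.Ioi d,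
        a ^ (r + 1) * Real.exp (-a) / (r + 1).factorial * productTail (M + 1) r (d / a)) := by
      rw [Measure.map_apply_of_aemeasurable hDm measurableSet_Ioi,
        ← lt_mul_mul_measure_prod hρ M hd, ← hjoint, Measure.map_apply_of_aemeasurable
          (hA.prodMk (hZ.prodMk hW)) (measurableSet_lt measurable_const (by fun_prop))]
      refine measure_congr ?_
      filter_upwards [hDW] with ω hω
      exact congrArg (fun x => d < x) hω
    rw [cdf_eq_real, ← Set.compl_Ioi, probReal_compl_eq_one_sub measurableSet_Ioi,
      measureReal_def, htail,
      ENNReal.toReal_ofReal (integral_erlang_density_mul_productTail_nonneg M r hd)]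

theorem theorem2
    {Ω₀ Ω : Type*} [MeasurableSpace Ω₀] [MeasurableSpace Ω]
    (P₀ : Measure Ω₀) [IsProbabilityMeasure P₀] (P : Measure Ω) [IsProbabilityMeasure P]
    (N K B : ℕ) (hN : 2 ≤ N)
    -- a Rayleigh fading channel vector and the random vector quantization of its direction
    (h : Ω₀ → EuclideanSpace ℂ (Fin N)) (c : Fin (2 ^ B) → Ω₀ → EuclideanSpace ℂ (Fin N))
    (q : Ω₀ → EuclideanSpace ℂ (Fin N)) (hq : IsRVQ P₀ h c q)
    -- the CSI at the base station: path-loss coefficients and quantized directions of all users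
    (ξ : Fin K → ℝ) (hξ : ∀ i, 0 < ξ i)
    (hhat : Ω → Fin K → EuclideanSpace ℂ (Fin N)) (hhat_meas : AEMeasurable hhat P)
    (hhat_unit : ∀ᵐ ω ∂P, ∀ i, ‖hhat ω i‖ = 1)
    (hhat_indep : ∀ᵐ ω ∂P, LinearIndependent ℂ (hhat ω))
    (j k : Fin K) (hjk : k ≠ j)
    -- the reconstruction at the base station of the channel of user `j`
    (A Z : Ω → ℝ) (e : Ω → EuclideanSpace ℂ (Fin N)) (he : AEMeasurable e P)
    (hA : IdentDistrib A (fun ω => ‖h ω‖ ^ 2) P P₀)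
    (hZ : IdentDistrib Z (fun ω => sinSqAngle (h ω) (q ω)) P P₀)
    (he_iso : ∀ᵐ H ∂(P.map hhat), IsIsotropicIn (condDistrib e hhat P H) (ℂ ∙ H j)ᗮ)
    (hA_indep : IndepFun A (fun ω => (Z ω, hhat ω, e ω)) P)
    (hZ_indep : IndepFun Z (fun ω => (hhat ω, e ω)) P)
    (D : Ω → ℝ)
    (hD : ∀ ω, D ω =
      leakage (A ω) (reconstructedDirection (Z ω) (hhat ω j) (e ω)) (zfVector ξ (hhat ω) k)) :
    AEMeasurable D P ∧
    (∀ d : ℝ, d ≤ 0 → cdf (P.map D) d = 0) ∧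
    ∀ d : ℝ, 0 < d → cdf (P.map D) d =
      1 + Real.exp (-d) / (N - 2).factorial *
          (∑ n ∈ Finset.Icc 0 (N - 2), ∑ m ∈ Finset.Icc 1 (2 ^ B),
            ((N - 2).choose n : ℝ) * ((2 ^ B).choose m : ℝ) *
              ((-1) ^ (n + m) * m / ((m : ℝ) * N - (m + n))) *
              ∑ l ∈ Finset.Icc 0 (N - 1 - n),
                (l.factorial : ℝ) * ((N - 1 - n).choose l : ℝ) * d ^ (N - 1 - l))
        - Real.exp (-d) / (N - 2).factorial *
          (∑ n ∈ Finset.Icc 0 (N - 2),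
            ((N - 2).choose n : ℝ) * ((2 ^ B).choose 1 : ℝ) *
              ((-1) ^ (n + 1) / ((N : ℝ) - 1 - n)) * d ^ (N - 1))
        - Real.exp (-d) / (N - 2).factorial *
          (∑ n ∈ Finset.Icc 0 (N - 2), ∑ m ∈ Finset.Icc 2 (2 ^ B),
            ((N - 2).choose n : ℝ) * ((2 ^ B).choose m : ℝ) *
              ((-1) ^ (n + m) * m / ((m : ℝ) * N - (m + n))) *
              ∑ l ∈ Finset.Icc 1 ((m - 1) * (N - 1) - 1),
                (-1) ^ (l - 1) * d ^ (N - 1 + l) /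
                  ((l.factorial : ℝ) * (((m - 1) * (N - 1) - 1).choose l : ℝ)))
        - expIntegralE1 d / (N - 2).factorial *
          (∑ n ∈ Finset.Icc 0 (N - 2), ∑ m ∈ Finset.Icc 2 (2 ^ B),
            ((N - 2).choose n : ℝ) * ((2 ^ B).choose m : ℝ) *
              ((-1) ^ (n + m) * m / ((m : ℝ) * N - (m + n))) *
              ((-1) ^ ((m - 1) * (N - 1) - 1) * d ^ (m * (N - 1)) /
                (((m - 1) * (N - 1) - 1).factorial : ℝ))) := by
  obtain ⟨r, rfl⟩ := Nat.exists_eq_add_of_le' hN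
  obtain ⟨M, hM⟩ : ∃ M, 2 ^ B = M + 1 := Nat.exists_eq_succ_of_ne_zero (by positivity)
  have hAlaw : P.map A = erlangMeasure (r + 1) := by
    rw [hA.map_eq, ← map_normSq_rayleighLaw, ← hq.channel_law.map_eq,
      AEMeasurable.map_map_of_aemeasurable (by fun_prop) hq.channel_law.aemeasurable]
    rfl
  have hZlaw : P.map Z = minBetaMeasure (r + 1) (M + 1) := by
    rw [hZ.map_eq, hq.map_sinSqAngle (by simp) hZ.aemeasurable_snd, hM]
  have hΦm := measurable_normSq_sum_mul_rightInverseZF (N := r + 2) ξ k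
  -- Almost surely `pinv` is given by the explicit right inverse; through this identity `D` inherits
  -- its measurability.
  have hDW : D =ᵐ[P] fun ω =>
      A ω * Z ω * ‖∑ n, e ω n * rightInverseZF ξ (hhat ω) k n‖ ^ 2 := by
    have hA0 := ae_of_ae_map hA.aemeasurable_fst (hAlaw ▸ ae_pos_erlangMeasure (r + 1))
    have hZ0 := ae_of_ae_map hZ.aemeasurable_fst (hZlaw ▸ ae_mem_Ioc_minBetaMeasure (r + 1) (M + 1))
    filter_upwards [hA0, hZ0, hhat_indep] with ω hA0 hZ0 hind
    obtain ⟨h1, -, h3⟩ := zfVector_properties hξ hind k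
    rw [hD, h1, leakage_reconstructedDirection hA0.le hZ0.1.le (h3 j hjk)]
  obtain ⟨hDm, hneg, hpos⟩ := cdf_map_mul_mul P hA.aemeasurable_fst hZ.aemeasurable_fst
    (hΦm.comp_aemeasurable (hhat_meas.prodMk he)) hAlaw hZlaw
    (hasBetaOneTail_zeroForcing P hξ hhat_meas hhat_indep hjk he he_iso)
    (hA_indep.comp measurable_id (measurable_fst.prodMk (hΦm.comp measurable_snd)))
    (hZ_indep.comp measurable_id hΦm) hDW
  refine ⟨hDm, hneg, fun d hd => ?_⟩
  rw [hpos d hd, hM, one_sub_integral_erlang_density_mul_productTail M r hd]
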